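/- Let $R$ be a complete discrete valuation ring with residue field $k$ and field of fractions $K$. An $R$-order is an $R$-algebra $\Lambda$, finitely generated and projective as an $R$-module, such that $K\otimes_R\Lambda$ is a semisimple $K$-algebra. A Brauer tree is a finite tree $\Gamma$ with, for each vertex $v$, a transitive permutation $\sigma_v$ of the set $E_v$ of edges adjacent to $v$, together with a distinguished (exceptional) vertex $v_0$ and an integer $\mu>0$, the exceptional multiplicity. Put $\mu_{v_0}=\mu$ and $\mu_v=1$ for $v\neq v_0$. The tree has no exceptional vertex if $\mu=1$, and it is a stem if $|E_v|\le 2$ for every vertex $v$. A Brauer tree algebra over $k$ associated to $\Gamma$ is a finite-dimensional symmetric $k$-algebra $B$ whose simple modules are, up to isomorphism, $S_e$, one for each edge $e$ of $\Gamma$ (pairwise non-isomorphic for distinct edges), such that the projective cover $P_e$ of $S_e$ satisfies $\mathrm{soc}(P_e)\subseteq\mathrm{rad}(P_e)$ and $\mathrm{rad}(P_e)/\mathrm{soc}(P_e)=U_{v}\oplus U_{w}$, where $v,w$ are the two vertices of $e$ and, for each $u\in\{v,w\}$, the module $U_u$ is uniserial of composition length $\mu_u|E_u|-1$ with $\mathrm{rad}^i(U_u)/\mathrm{rad}^{i+1}(U_u)\cong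 S_{\sigma_u^{i+1}(e)}$ for every $i\ge 0$ for which this quotient is nonzero. Let $B$ be a Brauer tree algebra over $k$ associated to a Brauer tree which is a stem without exceptional vertex, let $I$ be a two-sided ideal of $B$ with $0\neq I\neq B$, and let $\Lambda$ be an $R$-order with $\Lambda\otimes_R k\cong B/I$ as $k$-algebras. Then $$\mathrm{rank}_{\mathbb Z}\,K_0(K\otimes_R\Lambda)\le \mathrm{rank}_{\mathbb Z}\,K_0(B/I),$$ where $K_0(A)$ denotes the Grothendieck group of finitely generated projective left $A$-modules. -/

import Mathlib

open scoped TensorProduct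

universe u v w x

/-! ### The Grothendieck group of finitely generated projective modules -/

/-- A finitely generated projective left `A`-module. -/
structure FGProjModule (A : Type u) [Ring A] : Type (u + 1) where
  carrier : Type u
  [addCommGroup : AddCommGroup carrier]
  [module : Module A carrier]
  [finite : Module.Finite A carrier]
  [projective : Module.Projective A carrier]

attribute [instance] FGProjModule.addCommGroup FGProjModule.module
  FGProjModule.finite FGProjModule.projective

/-- The relations `[P] = [Q] + [Q']` whenever `P ≅ Q ⊕ Q'`. -/
def K0Relations (A : Type u) [Ring A] : AddSubgroup (FreeAbelianGroup (FGProjModule A)) :=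
  AddSubgroup.closure
    {z | ∃ P Q Q' : FGProjModule A, Nonempty (P.carrier ≃ₗ[A] (Q.carrier × Q'.carrier)) ∧
      z = FreeAbelianGroup.of P - (FreeAbelianGroup.of Q + FreeAbelianGroup.of Q')}

/-- `K₀(A)`: the Grothendieck group of the finitely generated projective left `A`-modules. -/
abbrev K0 (A : Type u) [Ring A] : Type (u + 1) :=
  FreeAbelianGroup (FGProjModule A) ⧸ K0Relations A

/-! ### Orders -/

/-- An `R`-order, for an integral domain `R` with field of fractions `K`: an `R`-algebra which is
finitely generated projective as `R`-module and such that `K ⊗ Λ` is a semisimple algebra. -/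
structure IsROrder (R : Type u) (K : Type v) (Λ : Type w) [CommRing R] [Field K] [Algebra R K]
    [Ring Λ] [Algebra R Λ] : Prop where
  finite : Module.Finite R Λ
  projective : Module.Projective R Λ
  semisimple : IsSemisimpleRing (K ⊗[R] Λ)

/-! ### Brauer trees -/

/-- A Brauer tree on the finite vertex set `V`: a tree, a transitive permutation of the edges
adjacent to each vertex, an exceptional vertex and its multiplicity. -/
structure BrauerTree (V : Type x) [Finite V] where
  graph : SimpleGraph V
  isTree : graph.IsTree
  perm : ∀ v : V, Equiv.Perm (graph.incidenceSet v)
  perm_transitive : ∀ (v : V) (e f : graph.incidenceSet v), (perm v).SameCycle e f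
  exceptional : V
  mult : ℕ
  mult_pos : 0 < mult

namespace BrauerTree

variable {V : Type x} [Finite V] (Γ : BrauerTree V)

/-- The set of edges of the Brauer tree. -/
abbrev Edge : Type x := Γ.graph.edgeSet

/-- The multiplicity of a vertex: `mult` at the exceptional vertex, `1` elsewhere. -/
noncomputable def multAt (v : V) : ℕ := by
  classical exact if v = Γ.exceptional then Γ.mult else 1

/-- The edge `σ_v ^ i (e)`, for an edge `e` adjacent to the vertex `v`. -/
def rotate (v : V) (e : Γ.Edge) (hv : v ∈ (e : Sym2 V)) (i : ℕ) : Γ.Edge :=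
  let f : Γ.graph.incidenceSet v := ((Γ.perm v) ^ i) ⟨e.1, e.2, hv⟩
  ⟨f.1, f.2.1⟩

/-- A stem: each vertex has at most two edges adjacent to it. -/
def IsStem : Prop := ∀ v : V, (Γ.graph.incidenceSet v).ncard ≤ 2

/-- A Brauer tree has no exceptional vertex if the exceptional multiplicity is `1`. -/
def NoExceptionalVertex : Prop := Γ.mult = 1

end BrauerTree

/-! ### Some module theory -/

section ModuleTheory

variable {A : Type u} [Ring A] {M : Type v} [AddCommGroup M] [Module A M]

/-- The radical `rad(N)` of a submodule `N ≤ M`, as a submodule of `M`. -/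
def Submodule.rad (N : Submodule A M) : Submodule A M := (Module.jacobson A N).map N.subtype

/-- The iterated radical `rad^i(N)` of a submodule `N ≤ M`, as a submodule of `M`. -/
def Submodule.radPow (N : Submodule A M) : ℕ → Submodule A M
  | 0 => N
  | i + 1 => (N.radPow i).rad

/-- The `i`-th radical quotient `rad^i(N) / rad^(i+1)(N)`. -/
abbrev Submodule.RadLayer (N : Submodule A M) (i : ℕ) : Type v :=
  N.radPow i ⧸ (N.radPow (i + 1)).comap (N.radPow i).subtype

variable (A M)

/-- The socle: the sum of the simple submodules. -/
def Module.soc : Submodule A M := sSup {N : Submodule A M | IsSimpleModule A N}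

/-- The subquotient `rad(M) / soc(M)` (used when `soc(M) ≤ rad(M)`). -/
abbrev Module.Heart : Type v :=
  Module.jacobson A M ⧸ (Module.soc A M).comap (Module.jacobson A M).subtype

/-- A uniserial module: its submodules form a chain. -/
def Module.IsUniserial : Prop := ∀ N N' : Submodule A M, N ≤ N' ∨ N' ≤ N

variable {A M}

/-- `π : P → M` is a projective cover: `P` is projective, `π` is surjective, and its kernel is
superfluous. -/
structure IsProjCover {P : Type w} [AddCommGroup P] [Module A P] (π : P →ₗ[A] M) : Prop where
  projective : Module.Projective A P
  surjective : Function.Surjective π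
  superfluous : ∀ N : Submodule A P, N ⊔ LinearMap.ker π = ⊤ → N = ⊤

end ModuleTheory

/-! ### Brauer tree algebras -/

/-- A symmetric algebra: there is a linear form which is symmetric, `l (a b) = l (b a)`, and
nondegenerate, i.e. its kernel contains no nonzero one-sided ideal. -/
def IsSymmetricAlg (k : Type u) (B : Type v) [Field k] [Ring B] [Algebra k B] : Prop :=
  ∃ l : B →ₗ[k] k, (∀ a b, l (a * b) = l (b * a)) ∧ ∀ a, (∀ b, l (a * b) = 0) → a = 0

/-- The shape that the Brauer tree `Γ` prescribes for the projective cover `P` of the simple module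
`S e`: `rad(P) / soc(P)` is the direct sum of uniserial modules `U v`, one for each of the two
vertices `v` of `e`, of composition length `mult(v) * |E_v| - 1`, and the `i`-th nonzero radical
quotient of `U v` is `S (σ_v ^ (i + 1) (e))`. -/
structure BrauerTree.HasShape {V : Type x} [Finite V] (Γ : BrauerTree V) (B : Type v) [Ring B]
    (S : Γ.Edge → ModuleCat.{v} B) (e : Γ.Edge) (P : ModuleCat.{v} B)
    (U : V → Submodule B (Module.Heart B P)) : Prop where
  soc_le : Module.soc B P ≤ Module.jacobson B P
  isCompl : ∀ v w : V, (e : Sym2 V) = s(v, w) → IsCompl (U v) (U w)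
  uniserial : ∀ v ∈ (e : Sym2 V), Module.IsUniserial B (U v)
  length : ∀ v ∈ (e : Sym2 V),
    Module.length B (U v) = ((Γ.multAt v * (Γ.graph.incidenceSet v).ncard - 1 : ℕ) : ℕ∞)
  layer : ∀ (v : V) (hv : v ∈ (e : Sym2 V)) (i : ℕ), Nontrivial ((U v).RadLayer i) →
    Nonempty ((U v).RadLayer i ≃ₗ[B] S (Γ.rotate v e hv (i + 1)))

/-- `B` is a Brauer tree algebra over the field `k` associated to the Brauer tree `Γ`. -/
structure IsBrauerTreeAlgebra (k : Type u) (B : Type v) [Field k] [Ring B] [Algebra k B]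
    {V : Type x} [Finite V] (Γ : BrauerTree V) : Prop where
  finite : Module.Finite k B
  symmetric : IsSymmetricAlg k B
  /-- The simple modules `S e` are parameterised by the edges, and the projective cover `P e` of
  `S e` has the prescribed shape. -/
  shape : ∃ S : Γ.Edge → ModuleCat.{v} B,
    (∀ e, IsSimpleModule B (S e)) ∧
    (∀ e f, Nonempty (S e ≃ₗ[B] S f) → e = f) ∧
    (∀ M : ModuleCat.{v} B, IsSimpleModule B M → ∃ e, Nonempty (M ≃ₗ[B] S e)) ∧
    ∀ e, ∃ (P : ModuleCat.{v} B) (π : P →ₗ[B] S e) (U : V → Submodule B (Module.Heart B P)),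
      IsProjCover π ∧ Γ.HasShape B S e P U

/-! Let `i e` be an idempotent defining the projective cover of the simple module of the edge `e`,
let `J e` consist of the elements of `i e B i e` that kill a generator's image in the top, and let
`δ e` be the codimension of `J e`. In a stem without exceptional vertex the heart of a projective
cover has only neighbouring simples as constituents. Hence `dim (i e B i e) ≤ 2 δ e`, and `i f B i e
≠ 0` whenever `f` is a rotation of `e`. If the ideal meets `B i e` nontrivially, symmetry makes it
remove at least `δ e` dimensions from `i e B i e`; otherwise `B i e` survives intact, along with its
links. Since the ideal is nonzero, the first case occurs for some edge
(`PeirceBounds.of_surjective`).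

These bounds lift from the residue algebra to the semisimple algebra `K ⊗ Λ`
(`PeirceBounds.exists_lift`). There every nonzero submodule of the module of a lifted idempotent `ε
e` has Peirce component of dimension at least `δ e`, so that module has at most two simple summands,
and at most one if `e` is small. Starting at a small edge and moving along the tree, one summand is
known from the neighbour, and the other is a difference of known classes. Thus the classes of the
modules of the nonzero `ε e` generate `K₀` (`PeirceBounds.addSubgroup_eq_top`). No more of the `ε e`
are nonzero than of the images of the `i e` in the quotient, and these have independent classes in
`K₀` of the quotient (`K0.card_le_rank_of_surjective`). -/

/-! ### Peirce components of left ideals -/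

section Peirce

variable {k : Type*} {A : Type*} [Field k] [Ring A] [Algebra k A]

/-- The Peirce component `{x ∈ N | e x = x}` of a left ideal `N`. -/
def Ideal.leftPart (k : Type*) {A : Type*} [Field k] [Ring A] [Algebra k A]
    (N : Ideal A) (e : A) : Submodule k A where
  carrier := {x | x ∈ N ∧ e * x = x}
  add_mem' := fun ⟨h₁, h₂⟩ ⟨h₃, h₄⟩ => ⟨N.add_mem h₁ h₃, by rw [mul_add, h₂, h₄]⟩
  zero_mem' := ⟨N.zero_mem, mul_zero e⟩
  smul_mem' := fun c x ⟨h₁, h₂⟩ => ⟨by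
    rw [Algebra.smul_def]; exact N.mul_mem_left _ h₁, by rw [mul_smul_comm, h₂]⟩

theorem Ideal.mem_leftPart {N : Ideal A} {e x : A} : x ∈ N.leftPart k e ↔ x ∈ N ∧ e * x = x :=
  Iff.rfl

theorem IsIdempotentElem.mem_span_singleton_iff {e x : A} (he : IsIdempotentElem e) :
    x ∈ Ideal.span {e} ↔ x * e = x := by
  rw [Ideal.mem_span_singleton']
  constructor
  · rintro ⟨a, rfl⟩
    rw [mul_assoc, he.eq]
  · intro h
    exact ⟨x, h⟩

theorem IsIdempotentElem.leftPart_span_eq_range {e : A} (he : IsIdempotentElem e) :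
    (Ideal.span {e}).leftPart k e =
      LinearMap.range (LinearMap.mulLeft k e ∘ₗ LinearMap.mulRight k e) := by
  ext x
  rw [Ideal.mem_leftPart, he.mem_span_singleton_iff]
  constructor
  · rintro ⟨h₁, h₂⟩
    exact ⟨x, by simp [h₁, h₂]⟩
  · rintro ⟨y, rfl⟩
    simp only [LinearMap.comp_apply, LinearMap.mulLeft_apply, LinearMap.mulRight_apply]
    exact ⟨by simp [mul_assoc, he.eq], by simp [← mul_assoc, he.eq]⟩

/-- Bounds on the Peirce components of an algebra with respect to a family of idempotents `j`: the
left ideals have Peirce components of dimension zero or at least `δ`, the dimension of `j e A j e`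
is at most `2 δ e`, and the idempotents `j e` with `dim (j e A j e) > δ e` are linked to those
related to them by `r`. -/
structure PeirceBounds (k : Type*) {A ι : Type*} [Field k] [Ring A] [Algebra k A]
    (j : ι → A) (δ : ι → ℕ) (r : ι → ι → Prop) : Prop where
  idem : ∀ e, IsIdempotentElem (j e)
  pos : ∀ e, 0 < δ e
  generate : ∀ N : Ideal A, (∀ e a, j e * a ∈ N) → N = ⊤
  lower : ∀ (N : Ideal A) (e : ι) (x : A), x ∈ N → j e * x = x → x ≠ 0 →
    δ e ≤ Module.finrank k (N.leftPart k (j e))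
  upper : ∀ e, Module.finrank k ((Ideal.span {j e}).leftPart k (j e)) ≤ 2 * δ e
  linked : ∀ e, Module.finrank k ((Ideal.span {j e}).leftPart k (j e)) ≤ δ e ∨
    ∀ f, r f e → ∃ a, j f * a * j e ≠ 0
  exists_small : ∃ e, Module.finrank k ((Ideal.span {j e}).leftPart k (j e)) ≤ δ e
  connected : ∀ e f, Relation.ReflTransGen r e f

end Peirce

/-! ### Lifting idempotents -/

section Lifting

variable {R : Type*} [CommRing R] [IsDomain R] [IsDiscreteValuationRing R]
variable {Λ : Type*} [Ring Λ] [Algebra R Λ] [Module.Finite R Λ] [Module.Free R Λ]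

theorem eq_zero_of_forall_smul_pow {M : Type*} [AddCommGroup M] [Module R M] [Module.Finite R M]
    {ϖ : R} (hϖ : Irreducible ϖ) {x : M} (h : ∀ n : ℕ, ∃ c : M, x = ϖ ^ n • c) : x = 0 := by
  refine IsHausdorff.haus (I := IsLocalRing.maximalIdeal R) inferInstance x fun n => ?_
  obtain ⟨c, rfl⟩ := h n
  rw [SModEq.zero]
  exact Submodule.smul_mem_smul (Ideal.pow_mem_pow
    (hϖ.maximalIdeal_eq ▸ Ideal.mem_span_singleton_self ϖ) n) trivial

/-- Completeness of `R` is applied to each coordinate in a basis of `M`. -/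
theorem exists_limit_of_cauchy [IsAdicComplete (IsLocalRing.maximalIdeal R) R]
    {M : Type*} [AddCommGroup M] [Module R M] [Module.Finite R M] [Module.Free R M]
    {ϖ : R} (hϖ : Irreducible ϖ) (a c : ℕ → M) (h : ∀ n, a (n + 1) - a n = ϖ ^ n • c n) :
    ∃ L : M, ∀ n, ∃ d : M, L - a n = ϖ ^ n • d := by
  have hm : ∀ n, (IsLocalRing.maximalIdeal R ^ n • (⊤ : Submodule R R)) =
      Ideal.span {ϖ ^ n} := fun n => by
    rw [hϖ.maximalIdeal_eq, Ideal.span_singleton_pow, smul_eq_mul, Ideal.mul_top]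
  let b := Module.Free.chooseBasis R M
  have key : ∀ i, ∃ l : R, ∀ n, ϖ ^ n ∣ l - b.repr (a n) i := by
    intro i
    have hle : ∀ m n, m ≤ n → ϖ ^ m ∣ b.repr (a n) i - b.repr (a m) i := by
      intro m n hmn
      induction n, hmn using Nat.le_induction with
      | base => simp
      | succ n hmn ih =>
        have h1 : b.repr (a (n + 1)) i - b.repr (a n) i = ϖ ^ n * b.repr (c n) i := by
          have := congrArg (fun y => b.repr y i) (h n)
          simpa using this
        have h2 : ϖ ^ m ∣ b.repr (a (n + 1)) i - b.repr (a n) i :=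
          h1 ▸ (pow_dvd_pow ϖ hmn).mul_right _
        simpa using dvd_add h2 ih
    obtain ⟨l, hl⟩ := IsPrecomplete.prec (I := IsLocalRing.maximalIdeal R) (M := R) inferInstance
      (f := fun n => b.repr (a n) i) (by
        intro m n hmn
        rw [SModEq.sub_mem, hm, Ideal.mem_span_singleton, ← dvd_neg, neg_sub]
        exact hle m n hmn)
    refine ⟨l, fun n => ?_⟩
    have := hl n
    rwa [SModEq.sub_mem, hm, Ideal.mem_span_singleton, ← dvd_neg, neg_sub] at this
  choose l hl using key
  refine ⟨b.equivFun.symm l, fun n => ?_⟩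
  choose d hd using fun i => hl i n
  refine ⟨b.equivFun.symm d, ?_⟩
  apply b.equivFun.injective
  rw [map_sub, map_smul, LinearEquiv.apply_symm_apply, LinearEquiv.apply_symm_apply]
  ext i
  exact hd i

/-- Newton iteration for `a² - a`: the polynomial `3a² - 2a³` squares the error up to a factor, and
the iterates converge. -/
theorem exists_isIdempotentElem_lift [IsAdicComplete (IsLocalRing.maximalIdeal R) R]
    {ϖ : R} (hϖ : Irreducible ϖ) (a₀ c₀ : Λ) (h₀ : a₀ * a₀ - a₀ = ϖ • c₀) :
    ∃ e d : Λ, IsIdempotentElem e ∧ e - a₀ = ϖ • d := by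
  let step : Λ → Λ := fun a => 3 * (a * a) - 2 * (a * a * a)
  let s : ℕ → Λ := fun n => step^[n] a₀
  have hs : ∀ n, s (n + 1) = step (s n) := fun n => Function.iterate_succ_apply' step n a₀
  have hstep : ∀ a : Λ, step a * step a - step a =
      (a * a - a) * (a * a - a) * (4 * (a * a) - 4 * a - 3) := by
    intro a; simp only [step]; noncomm_ring
  have hdiff : ∀ a : Λ, step a - a = (a * a - a) * (1 - 2 * a) := by
    intro a; simp only [step]; noncomm_ring
  have hd : ∀ n, ∃ c : Λ, s n * s n - s n = ϖ ^ (n + 1) • c := by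
    intro n
    induction n with
    | zero => exact ⟨c₀, by simpa [s] using h₀⟩
    | succ n ih =>
      obtain ⟨c, hc⟩ := ih
      -- The squared error carries `ϖ ^ (2n + 2)`; only `ϖ ^ (n + 2)` is kept, and the surplus `ϖ ^
      -- n` goes into the witness.
      refine ⟨ϖ ^ n • (c * c * (4 * (s n * s n) - 4 * s n - 3)), ?_⟩
      rw [hs, hstep, hc, smul_mul_smul_comm, smul_mul_assoc, smul_smul, ← pow_add, ← pow_add]
      congr 2; ring
  choose c hc using hd
  obtain ⟨e, he⟩ := exists_limit_of_cauchy hϖ s (fun n => ϖ • (c n * (1 - 2 * s n))) (fun n => by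
    rw [hs, hdiff, hc, smul_mul_assoc, smul_smul, pow_succ])
  have hidem : e * e - e = 0 := by
    refine eq_zero_of_forall_smul_pow hϖ fun n => ?_
    obtain ⟨d, hd⟩ := he n
    refine ⟨d * e + s n * d - d + ϖ • c n, ?_⟩
    have h1 : e * e - e = (e - s n) * e + s n * (e - s n) - (e - s n) + (s n * s n - s n) := by
      noncomm_ring
    rw [h1, hd, hc, pow_succ, mul_smul, smul_mul_assoc, mul_smul_comm, ← smul_add, ← smul_sub,
      ← smul_add]
  -- At index 0 the estimate is vacuous; the first iterate is itself congruent to `a₀` modulo `ϖ`.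
  obtain ⟨d, hd⟩ := he 1
  refine ⟨e, d + c₀ * (1 - 2 * a₀), sub_eq_zero.mp hidem, ?_⟩
  have h1 : s 1 - a₀ = ϖ • (c₀ * (1 - 2 * a₀)) := by
    rw [show s 1 = step a₀ from rfl, hdiff, h₀, smul_mul_assoc]
  rw [smul_add, ← h1, ← pow_one ϖ, ← hd]
  abel

end Lifting

/-! ### From the residue algebra to the generic fibre -/

section Transport

variable {R : Type u} [CommRing R] [IsDomain R] [IsDiscreteValuationRing R]
variable {K : Type v} [Field K] [Algebra R K] [IsFractionRing R K]
variable {Λ : Type x} [Ring Λ] [Algebra R Λ]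

/-- The range of an idempotent is a direct summand, so its inclusion stays injective after base
change. -/
theorem LinearMap.finrank_range_baseChange_of_isIdempotentElem
    [Module.Finite R Λ] [Module.Free R Λ] (T : Type*) [Field T] [Algebra R T]
    {p : Λ →ₗ[R] Λ} (hp : ∀ x, p (p x) = p x) :
    Module.finrank T (LinearMap.range (p.baseChange T)) =
      Module.finrank R (LinearMap.range p) := by
  have h1 : p = (LinearMap.range p).subtype ∘ₗ p.rangeRestrict := rfl
  have h2 : p.rangeRestrict ∘ₗ (LinearMap.range p).subtype = LinearMap.id := by
    ext ⟨_, y, rfl⟩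
    simp [hp]
  have h3 : (p.rangeRestrict.baseChange T) ∘ₗ ((LinearMap.range p).subtype.baseChange T) =
      LinearMap.id := by
    rw [← LinearMap.baseChange_comp, h2, LinearMap.baseChange_id]
  have h4 : LinearMap.range (p.baseChange T) =
      LinearMap.range ((LinearMap.range p).subtype.baseChange T) := by
    conv_lhs => rw [h1, LinearMap.baseChange_comp]
    rw [LinearMap.range_comp_of_range_eq_top]
    rw [LinearMap.range_eq_top]
    exact fun y => ⟨_, LinearMap.congr_fun h3 y⟩
  rw [h4, LinearMap.finrank_range_of_inj, Module.finrank_baseChange]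
  exact Function.LeftInverse.injective (g := p.rangeRestrict.baseChange T)
    fun y => LinearMap.congr_fun h3 y

theorem finrank_leftPart_span_one_tmul [Module.Finite R Λ] [Module.Free R Λ]
    (T : Type*) [Field T] [Algebra R T] {e : Λ}
    (he : IsIdempotentElem e) :
    Module.finrank T ((Ideal.span {(1 : T) ⊗ₜ[R] e}).leftPart T ((1 : T) ⊗ₜ[R] e)) =
      Module.finrank R (LinearMap.range (LinearMap.mulLeft R e ∘ₗ LinearMap.mulRight R e)) := by
  have he' : IsIdempotentElem ((1 : T) ⊗ₜ[R] e) := by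
    simp [IsIdempotentElem, Algebra.TensorProduct.tmul_mul_tmul, he.eq]
  have hmap : LinearMap.mulLeft T ((1 : T) ⊗ₜ[R] e) ∘ₗ LinearMap.mulRight T ((1 : T) ⊗ₜ[R] e) =
      (LinearMap.mulLeft R e ∘ₗ LinearMap.mulRight R e).baseChange T := by
    ext x
    simp [Algebra.TensorProduct.tmul_mul_tmul]
  rw [he'.leftPart_span_eq_range, hmap,
    LinearMap.finrank_range_baseChange_of_isIdempotentElem]
  intro x
  simp only [LinearMap.comp_apply, LinearMap.mulLeft_apply, LinearMap.mulRight_apply]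
  simp only [mul_assoc, he.eq]
  simp only [← mul_assoc, he.eq]

theorem one_tmul_residue_eq_zero_iff {ϖ : R} (hϖ : Irreducible ϖ) {x : Λ} :
    (1 : IsLocalRing.ResidueField R) ⊗ₜ[R] x = 0 ↔ ∃ y, x = ϖ • y := by
  have h : LinearMap.ker (TensorProduct.mk R (IsLocalRing.ResidueField R) Λ 1) =
      IsLocalRing.maximalIdeal R • ⊤ :=
    LinearMap.ker_tensorProductMk (I := IsLocalRing.maximalIdeal R) Λ
  have h2 : (1 : IsLocalRing.ResidueField R) ⊗ₜ[R] x = 0 ↔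
      x ∈ LinearMap.ker (TensorProduct.mk R (IsLocalRing.ResidueField R) Λ 1) := by
    simp
  rw [h2, h, hϖ.maximalIdeal_eq, Submodule.ideal_span_singleton_smul,
    Submodule.mem_smul_pointwise_iff_exists]
  simp [eq_comm]

theorem one_tmul_residue_surjective :
    Function.Surjective
      (Algebra.TensorProduct.includeRight : Λ →ₐ[R] IsLocalRing.ResidueField R ⊗[R] Λ) :=
  TensorProduct.mk_surjective R Λ (IsLocalRing.ResidueField R) IsLocalRing.residue_surjective

theorem one_tmul_fraction_injective [Module.Free R Λ] :
    Function.Injective (Algebra.TensorProduct.includeRight : Λ →ₐ[R] K ⊗[R] Λ) :=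
  Algebra.TensorProduct.includeRight_injective (IsFractionRing.injective R K)

theorem exists_smul_eq_one_tmul (z : K ⊗[R] Λ) :
    ∃ (r : R) (y : Λ), r ≠ 0 ∧ r • z = (1 : K) ⊗ₜ[R] y := by
  induction z with
  | zero => exact ⟨1, 0, one_ne_zero, by simp⟩
  | tmul c y =>
    obtain ⟨a, s, hs, rfl⟩ := IsFractionRing.div_surjective (A := R) c
    have hs0 : algebraMap R K s ≠ 0 := by
      simpa using nonZeroDivisors.ne_zero hs
    refine ⟨s, a • y, nonZeroDivisors.ne_zero hs, ?_⟩
    rw [TensorProduct.smul_tmul', TensorProduct.tmul_smul, TensorProduct.smul_tmul',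
      Algebra.smul_def, Algebra.smul_def, mul_div_cancel₀ _ hs0, mul_one]
  | add z₁ z₂ h₁ h₂ =>
    obtain ⟨r₁, y₁, hr₁, e₁⟩ := h₁
    obtain ⟨r₂, y₂, hr₂, e₂⟩ := h₂
    refine ⟨r₁ * r₂, r₂ • y₁ + r₁ • y₂, mul_ne_zero hr₁ hr₂, ?_⟩
    rw [smul_add, TensorProduct.tmul_add, TensorProduct.tmul_smul, TensorProduct.tmul_smul, ← e₁,
      ← e₂, smul_smul, smul_smul, mul_comm r₂ r₁]

theorem exists_pow_smul_not_dvd {M : Type*} [AddCommGroup M] [Module R M] [Module.Finite R M]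
    {ϖ : R} (hϖ : Irreducible ϖ) {x : M} (hx : x ≠ 0) :
    ∃ (n : ℕ) (y : M), x = ϖ ^ n • y ∧ ¬ ∃ z, y = ϖ • z := by
  by_contra! H
  refine hx (eq_zero_of_forall_smul_pow hϖ fun n => ?_)
  induction n with
  | zero => exact ⟨x, by simp⟩
  | succ n ih =>
    obtain ⟨c, hc⟩ := ih
    obtain ⟨z, rfl⟩ := H n c hc
    exact ⟨z, by rw [hc, smul_smul, pow_succ]⟩

/-- The idempotents lift to `Λ`, and each corner `a Λ a` has the same rank over both fields. The
lower bound survives because a left ideal of `K ⊗ Λ` can be intersected with `Λ` and reduced without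
gaining dimension. -/
theorem PeirceBounds.exists_lift [Module.Finite R Λ] [Module.Free R Λ]
    [IsAdicComplete (IsLocalRing.maximalIdeal R) R]
    {ι : Type*} {j : ι → IsLocalRing.ResidueField R ⊗[R] Λ} {δ : ι → ℕ} {r : ι → ι → Prop}
    (h : PeirceBounds (IsLocalRing.ResidueField R) j δ r) :
    ∃ ε : ι → K ⊗[R] Λ, PeirceBounds K ε δ r ∧ ∀ e, j e = 0 → ε e = 0 := by
  obtain ⟨ϖ, hϖ⟩ := IsDiscreteValuationRing.exists_irreducible R
  let q : Λ →ₐ[R] IsLocalRing.ResidueField R ⊗[R] Λ := Algebra.TensorProduct.includeRight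
  let g : Λ →ₐ[R] K ⊗[R] Λ := Algebra.TensorProduct.includeRight
  have hq : Function.Surjective q := one_tmul_residue_surjective
  have hg : Function.Injective g := one_tmul_fraction_injective
  have hq0 : ∀ x, q x = 0 ↔ ∃ y, x = ϖ • y := fun x => one_tmul_residue_eq_zero_iff hϖ
  have hlift : ∀ e, ∃ a : Λ, IsIdempotentElem a ∧ q a = j e ∧ (j e = 0 → a = 0) := by
    intro e
    -- Zero is lifted to zero, so that passing to `K` creates no new nonzero idempotents.
    by_cases h0 : j e = 0
    · exact ⟨0, IsIdempotentElem.zero, by simp [h0], fun _ => rfl⟩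
    obtain ⟨a₀, ha₀⟩ := hq (j e)
    obtain ⟨c, hc⟩ := (hq0 (a₀ * a₀ - a₀)).mp (by
      rw [map_sub, map_mul, ha₀, (h.idem e).eq, sub_self])
    obtain ⟨a, d, ha, had⟩ := exists_isIdempotentElem_lift hϖ a₀ c hc
    refine ⟨a, ha, ?_, fun h => absurd h h0⟩
    rw [← ha₀, ← sub_eq_zero, ← map_sub]
    exact (hq0 _).mpr ⟨d, had⟩
  choose a ha hqa ha0 using hlift
  have hfin : ∀ e, Module.finrank K ((Ideal.span {g (a e)}).leftPart K (g (a e))) =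
      Module.finrank (IsLocalRing.ResidueField R)
        ((Ideal.span {j e}).leftPart (IsLocalRing.ResidueField R) (j e)) := by
    intro e
    rw [← hqa e]
    exact (finrank_leftPart_span_one_tmul K (ha e)).trans
      (finrank_leftPart_span_one_tmul (IsLocalRing.ResidueField R) (ha e)).symm
  refine ⟨fun e => g (a e), ⟨fun e => ?_, h.pos, ?_, ?_, ?_, ?_, ?_, h.connected⟩,
    fun e he => by simp [ha0 e he]⟩
  · simp only [IsIdempotentElem, ← map_mul, (ha e).eq]
  · intro N hN
    let T : Ideal Λ := N.comap g
    have hT : ∀ e x, a e * x ∈ T := fun e x => by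
      rw [Ideal.mem_comap, map_mul]; exact hN e _
    have hmap : Ideal.map q T = ⊤ := by
      refine h.generate _ fun e x => ?_
      obtain ⟨y, rfl⟩ := hq x
      rw [← hqa, ← map_mul]
      exact Ideal.mem_map_of_mem q (hT e y)
    -- Nakayama: `T` fills the reduction of `Λ`, hence is all of `Λ`.
    have htop : T.restrictScalars R = ⊤ := by
      rw [← IsLocalRing.map_tensorProduct_mk_eq_top, eq_top_iff]
      intro z _
      have hz : z ∈ Ideal.map q T := hmap ▸ trivial
      obtain ⟨t, ht, rfl⟩ := (Ideal.mem_map_iff_of_surjective q hq).mp hz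
      exact ⟨t, ht, rfl⟩
    have h1 : (1 : Λ) ∈ T.restrictScalars R := htop ▸ trivial
    have h1' : g 1 ∈ N := h1
    rw [map_one] at h1'
    exact (Ideal.eq_top_iff_one N).mpr h1'
  · intro V e x hx hex hx0
    have hVK : ∀ (c : K) (z : K ⊗[R] Λ), z ∈ V → c • z ∈ V := fun c z hz => by
      rw [Algebra.smul_def]; exact V.mul_mem_left _ hz
    have hVR : ∀ (c : R) (z : K ⊗[R] Λ), z ∈ V → c • z ∈ V := fun c z hz => by
      rw [← algebraMap_smul K]; exact hVK _ _ hz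
    have hcancel : ∀ (c : R) (z : K ⊗[R] Λ), c ≠ 0 → c • z ∈ V → z ∈ V := fun c z hc hz => by
      have hc' : algebraMap R K c ≠ 0 := by simpa using hc
      have := hVK (algebraMap R K c)⁻¹ _ hz
      rwa [← algebraMap_smul K c, smul_smul, inv_mul_cancel₀ hc', one_smul] at this
    have hinj : ∀ (c : R) (z : K ⊗[R] Λ), c ≠ 0 → c • z = 0 → z = 0 := fun c z hc hz => by
      have hc' : algebraMap R K c ≠ 0 := by simpa using hc
      rw [← algebraMap_smul K] at hz
      exact (smul_eq_zero.mp hz).resolve_left hc'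
    obtain ⟨s, y₀, hs, hy₀⟩ := exists_smul_eq_one_tmul x
    change s • x = g y₀ at hy₀
    have hy₀0 : y₀ ≠ 0 := by
      rintro rfl
      exact hx0 (hinj s x hs (by rw [hy₀, map_zero]))
    -- After clearing denominators, the largest power of `ϖ` is divided out, so that the reduction
    -- of `y` is nonzero while `y` still lies in `V`.
    obtain ⟨n, y, rfl, hy⟩ := exists_pow_smul_not_dvd hϖ hy₀0
    have hϖn : ϖ ^ n ≠ 0 := pow_ne_zero _ hϖ.ne_zero
    rw [map_smul] at hy₀
    have hyV : g y ∈ V := hcancel _ _ hϖn (hy₀ ▸ hVR s x hx)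
    have hey : a e * y = y := by
      apply hg
      rw [← sub_eq_zero]
      refine hinj _ _ hϖn ?_
      rw [smul_sub, map_mul, ← mul_smul_comm, ← hy₀, mul_smul_comm, hex, sub_self]
    have hqy : q y ≠ 0 := fun h0 => hy ((hq0 y).mp h0)
    let L : Ideal Λ := V.comap g
    refine (h.lower (Ideal.map q L) e (q y) (Ideal.mem_map_of_mem q hyV)
      (by rw [← hqa, ← map_mul, hey]) hqy).trans ?_
    let b := Module.finBasis (IsLocalRing.ResidueField R)
      ((Ideal.map q L).leftPart (IsLocalRing.ResidueField R) (j e))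
    have hb : ∀ i, ∃ z ∈ L, a e * z = z ∧ q z = (b i : IsLocalRing.ResidueField R ⊗[R] Λ) := by
      intro i
      obtain ⟨hb1, hb2⟩ := (b i).2
      obtain ⟨z, hz, hzb⟩ := (Ideal.mem_map_iff_of_surjective q hq).mp hb1
      exact ⟨a e * z, L.mul_mem_left _ hz, by rw [← mul_assoc, (ha e).eq], by
        rw [map_mul, hqa, hzb, hb2]⟩
    choose z hzL hze hzq using hb
    -- Elements of a free module with independent reductions are independent over `R`, hence over
    -- `K`.
    have hli : LinearIndependent R z := by
      refine Module.IsLocalRing.linearIndependent_of_flat z ?_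
      have : (TensorProduct.mk R (IsLocalRing.ResidueField R) Λ 1 ∘ z) =
          ((Ideal.map q L).leftPart (IsLocalRing.ResidueField R) (j e)).subtype ∘ b := funext hzq
      rw [this]
      exact b.linearIndependent.map' _ (Submodule.ker_subtype _)
    have hliK : LinearIndependent K (fun i => g (z i)) := by
      rw [← LinearIndependent.iff_fractionRing (R := R)]
      exact hli.map' g.toLinearMap (LinearMap.ker_eq_bot.mpr hg)
    let z' : Fin (Module.finrank (IsLocalRing.ResidueField R)
        ((Ideal.map q L).leftPart (IsLocalRing.ResidueField R) (j e))) → V.leftPart K (g (a e)) :=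
      fun i => ⟨g (z i), hzL i, by rw [← map_mul, hze]⟩
    have hliV : LinearIndependent K z' :=
      LinearIndependent.of_comp (V.leftPart K (g (a e))).subtype hliK
    simpa using hliV.fintype_card_le_finrank
  · intro e
    rw [hfin]
    exact h.upper e
  · intro e
    rw [hfin]
    refine (h.linked e).imp id fun H f hf => ?_
    obtain ⟨x, hx⟩ := H f hf
    obtain ⟨y, rfl⟩ := hq x
    refine ⟨g y, fun h0 => hx ?_⟩
    rw [← map_mul, ← map_mul, map_eq_zero_iff g hg] at h0
    rw [← hqa, ← hqa, ← map_mul, ← map_mul, h0, map_zero]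
  · obtain ⟨e, he⟩ := h.exists_small
    exact ⟨e, by rwa [hfin]⟩

end Transport

/-! ### Classes in `K₀` -/

section K0

variable {A : Type u} [Ring A]

/-- The class in `K₀` of a finitely generated projective module. -/
def K0.cls (A : Type u) [Ring A] (M : Type u) [AddCommGroup M] [Module A M] [Module.Finite A M]
    [Module.Projective A M] : K0 A :=
  QuotientAddGroup.mk (FreeAbelianGroup.of ⟨M⟩)

section

variable {M N N' : Type u} [AddCommGroup M] [Module A M] [Module.Finite A M]
  [Module.Projective A M] [AddCommGroup N] [Module A N] [Module.Finite A N]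
  [Module.Projective A N] [AddCommGroup N'] [Module A N'] [Module.Finite A N']
  [Module.Projective A N']

theorem K0.cls_eq_add (e : M ≃ₗ[A] (N × N')) : K0.cls A M = K0.cls A N + K0.cls A N' := by
  rw [← sub_eq_zero]
  refine (QuotientAddGroup.eq_zero_iff (N := K0Relations A) _).mpr ?_
  exact AddSubgroup.subset_closure ⟨⟨M⟩, ⟨N⟩, ⟨N'⟩, ⟨e⟩, rfl⟩

theorem K0.cls_eq_zero [Subsingleton M] : K0.cls A M = 0 := by
  have e : M ≃ₗ[A] (M × M) :=
    { toFun := fun _ => 0, invFun := fun _ => 0, map_add' := by simp, map_smul' := by simp,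
      left_inv := fun _ => Subsingleton.elim _ _, right_inv := fun _ => Subsingleton.elim _ _ }
  simpa using K0.cls_eq_add e

theorem K0.cls_congr (e : M ≃ₗ[A] N) : K0.cls A M = K0.cls A N := by
  have e' : M ≃ₗ[A] (N × PUnit.{u + 1}) := e.trans LinearEquiv.prodUnique.symm
  rw [K0.cls_eq_add e', K0.cls_eq_zero (M := PUnit.{u + 1}), add_zero]

end

theorem K0.addSubgroup_eq_top {H : AddSubgroup (K0 A)}
    (h : ∀ P : FGProjModule A, K0.cls A P.carrier ∈ H) : H = ⊤ := by
  rw [eq_top_iff]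
  rintro z -
  induction z using QuotientAddGroup.induction_on with
  | H z =>
    induction z using FreeAbelianGroup.induction_on with
    | zero => exact H.zero_mem
    | of P => exact h P
    | neg P hP => exact H.neg_mem hP
    | add a b ha hb => exact H.add_mem ha hb

end K0

/-! ### Generators of `K₀` of a semisimple algebra -/

theorem Ideal.finrank_leftPart_add_le {K E : Type*} [Field K] [Ring E] [Algebra K E]
    [Module.Finite K E] {N₁ N₂ N : Ideal E} (hd : Disjoint N₁ N₂)
    (hle : N₁ ⊔ N₂ ≤ N) (ε : E) :
    Module.finrank K (N₁.leftPart K ε) + Module.finrank K (N₂.leftPart K ε) ≤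
      Module.finrank K (N.leftPart K ε) := by
  rw [← Submodule.finrank_sup_add_finrank_inf_eq]
  have h1 : N₁.leftPart K ε ⊓ N₂.leftPart K ε = ⊥ := by
    rw [eq_bot_iff]
    rintro x ⟨h₁, h₂⟩
    exact Submodule.disjoint_def.mp hd x h₁.1 h₂.1
  rw [h1, finrank_bot, add_zero]
  refine Submodule.finrank_mono (sup_le ?_ ?_)
  · exact fun x hx => ⟨hle (le_sup_left (a := N₁) hx.1), hx.2⟩
  · exact fun x hx => ⟨hle (le_sup_right (a := N₁) hx.1), hx.2⟩

section SemisimpleK0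

attribute [local instance] Module.projective_of_isSemisimpleRing

variable {E : Type u} [Ring E] [IsSemisimpleRing E]

theorem K0.cls_sup {M : Type u} [AddCommGroup M] [Module E M] [Module.Finite E M]
    {N₁ N₂ : Submodule E M} (h : Disjoint N₁ N₂) :
    K0.cls E ↥(N₁ ⊔ N₂) = K0.cls E N₁ + K0.cls E N₂ := by
  refine K0.cls_eq_add (LinearEquiv.symm (LinearEquiv.ofBijective
    ((Submodule.inclusion (le_sup_left : N₁ ≤ N₁ ⊔ N₂)).coprod
      (Submodule.inclusion (le_sup_right : N₂ ≤ N₁ ⊔ N₂))) ⟨?_, ?_⟩))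
  · rw [injective_iff_map_eq_zero]
    rintro ⟨⟨a, ha⟩, ⟨b, hb⟩⟩ hab
    have hab' : a + b = 0 := congrArg Subtype.val hab
    have ha0 : a = 0 := Submodule.disjoint_def.mp h a ha
      (by rw [eq_neg_of_add_eq_zero_left hab']; exact N₂.neg_mem hb)
    subst ha0
    simp only [zero_add] at hab'
    subst hab'
    rfl
  · rintro ⟨c, hc⟩
    obtain ⟨a, ha, b, hb, rfl⟩ := Submodule.mem_sup.mp hc
    exact ⟨(⟨a, ha⟩, ⟨b, hb⟩), rfl⟩

theorem Submodule.exists_disjoint_sup_eq {M : Type*} [AddCommGroup M] [Module E M]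
    {V N : Submodule E M} (h : V ≤ N) : ∃ C : Submodule E M, Disjoint V C ∧ V ⊔ C = N := by
  obtain ⟨C, hC⟩ := ComplementedLattice.exists_isCompl V
  refine ⟨C ⊓ N, hC.disjoint.mono_right inf_le_left, ?_⟩
  rw [← sup_inf_assoc_of_le _ h, hC.sup_eq_top, top_inf_eq]

theorem K0.cls_mem_of_forall_isSimpleModule {H : AddSubgroup (K0 E)}
    (h : ∀ (S : Type u) [AddCommGroup S] [Module E S] [IsSimpleModule E S], K0.cls E S ∈ H) :
    H = ⊤ := by
  refine K0.addSubgroup_eq_top fun P => ?_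
  have key : ∀ N : Submodule E P.carrier, K0.cls E N ∈ H := by
    intro N
    induction N using WellFoundedLT.induction with
    | ind N ih =>
      rcases IsSemisimpleModule.eq_bot_or_exists_simple_le N with rfl | ⟨V, hV, hVs⟩
      · rw [K0.cls_eq_zero]; exact H.zero_mem
      · obtain ⟨C, hd, rfl⟩ := Submodule.exists_disjoint_sup_eq hV
        rw [K0.cls_sup hd]
        refine H.add_mem (h V) (ih C (lt_of_le_of_ne le_sup_right fun hC => ?_))
        have hVC : V ≤ C := hC ▸ le_sup_left
        exact (isSimpleModule_iff_isAtom.mp hVs).1 (hd.eq_bot_of_le hVC)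
  rw [← K0.cls_congr (Submodule.topEquiv (R := E) (M := P.carrier))]
  exact key ⊤

/-- The witness is the projection of `y` to the summand `V`: it is fixed by `ε` by linearity, and it
generates `V`, so it is nonzero. -/
theorem Ideal.exists_mul_eq_self_of_le_span {y ε : E} (hy : ε * y = y) {V : Ideal E} (hV : V ≠ ⊥)
    (hle : V ≤ Ideal.span {y}) : ∃ x ∈ V, ε * x = x ∧ x ≠ 0 := by
  obtain ⟨C, hC⟩ := ComplementedLattice.exists_isCompl V
  let π : E →ₗ[E] V := V.projectionOnto C hC
  have hπ : ∀ v : V, π v = v := fun v => Submodule.projectionOnto_apply_left hC v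
  refine ⟨π y, (π y).2, ?_, fun h0 => ?_⟩
  · have := π.map_smul ε y
    rw [smul_eq_mul, hy] at this
    exact (congrArg Subtype.val this).symm
  · obtain ⟨v, hv, hv0⟩ := Submodule.exists_mem_ne_zero_of_ne_bot hV
    obtain ⟨b, rfl⟩ := Ideal.mem_span_singleton'.mp (hle hv)
    have h1 := hπ ⟨b * y, hv⟩
    have h2 := π.map_smul b y
    rw [smul_eq_mul, show π y = 0 from Subtype.ext h0, smul_zero] at h2
    exact hv0 (congrArg Subtype.val (h1.symm.trans h2))

/-- The map `b ↦ b s` is nonzero from `E ε` to `S`, and semisimplicity turns the simple quotient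
into a submodule. -/
theorem Ideal.exists_simple_le_span_linearEquiv {ε : E} {S : Type*}
    [AddCommGroup S] [Module E S] [IsSimpleModule E S] {s : S} (hs : ε • s = s) (hs0 : s ≠ 0) :
    ∃ V : Ideal E, V ≤ Ideal.span {ε} ∧ IsSimpleModule E V ∧ Nonempty (V ≃ₗ[E] S) := by
  let f : Ideal.span {ε} →ₗ[E] S := LinearMap.toSpanSingleton E S s ∘ₗ (Ideal.span {ε}).subtype
  have hf : f ≠ 0 := fun h0 => hs0 (by
    have := LinearMap.congr_fun h0 ⟨ε, Ideal.mem_span_singleton_self ε⟩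
    simpa [f, hs] using this)
  obtain ⟨V, ⟨e⟩⟩ := LinearMap.linearEquiv_of_ne_zero hf
  let e' := (V.equivMapOfInjective (Ideal.span {ε}).subtype Subtype.val_injective).symm.trans e.symm
  exact ⟨V.map (Ideal.span {ε}).subtype, Submodule.map_subtype_le _ _,
    IsSimpleModule.congr e', ⟨e'⟩⟩

variable {K : Type*} [Field K] [Algebra K E] [Module.Finite K E]

variable {ι : Type*} {ε : ι → E} {δ : ι → ℕ} {r : ι → ι → Prop}

/-- Simple summands of the `E ε e` are captured edge by edge along `r`, beginning at a small edge.
Every simple module occurs among them, since the elements `ε e * a` lie in no common proper left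
ideal. -/
theorem PeirceBounds.addSubgroup_eq_top (h : PeirceBounds K ε δ r) {H : AddSubgroup (K0 E)}
    (hH : ∀ e, K0.cls E (Ideal.span {ε e}) ∈ H) : H = ⊤ := by
  have hdim : ∀ e (V : Ideal E), V ≠ ⊥ → V ≤ Ideal.span {ε e} →
      δ e ≤ Module.finrank K (V.leftPart K (ε e)) := by
    intro e V hV hle
    obtain ⟨x, hx, hex, hx0⟩ := Ideal.exists_mul_eq_self_of_le_span (h.idem e) hV hle
    exact h.lower V e x hx hex hx0
  have hne : ∀ V : Ideal E, IsSimpleModule E V → V ≠ ⊥ :=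
    fun V hV => (isSimpleModule_iff_isAtom.mp hV).1
  -- Two independent summands would need dimension `2 δ e`, so `V` is all of `E ε e`.
  have hsmall : ∀ e, Module.finrank K ((Ideal.span {ε e}).leftPart K (ε e)) ≤ δ e →
      ∀ V : Ideal E, IsSimpleModule E V → V ≤ Ideal.span {ε e} → K0.cls E V ∈ H := by
    intro e he V hV hle
    obtain ⟨C, hd, hC⟩ := Submodule.exists_disjoint_sup_eq hle
    have hC0 : C = ⊥ := by
      by_contra hC0
      have := Ideal.finrank_leftPart_add_le (K := K) hd hC.le (ε e)
      have := hdim e V (hne V hV) hle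
      have := hdim e C hC0 (hC ▸ le_sup_right)
      have := h.pos e
      omega
    rw [hC0, sup_bot_eq] at hC
    subst hC
    exact hH e
  -- A third summand would need dimension `3 δ e`, so `E ε e = V ⊕ V₁` and `[V] = [E ε e] - [V₁]`.
  have hlarge : ∀ e (V₁ : Ideal E), IsSimpleModule E V₁ → V₁ ≤ Ideal.span {ε e} →
      K0.cls E V₁ ∈ H →
      ∀ V : Ideal E, IsSimpleModule E V → V ≤ Ideal.span {ε e} → K0.cls E V ∈ H := by
    intro e V₁ hV₁ hle₁ hmem V hV hle
    by_cases heq : V = V₁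
    · subst heq; exact hmem
    have hd := (isSimpleModule_iff_isAtom.mp hV).disjoint_of_ne (isSimpleModule_iff_isAtom.mp hV₁)
      heq
    obtain ⟨C, hdC, hC⟩ := Submodule.exists_disjoint_sup_eq (sup_le hle hle₁)
    have hC0 : C = ⊥ := by
      by_contra hC0
      have := Ideal.finrank_leftPart_add_le (K := K) hdC hC.le (ε e)
      have := Ideal.finrank_leftPart_add_le (K := K) hd le_rfl (ε e)
      have := hdim e V (hne V hV) hle
      have := hdim e V₁ (hne V₁ hV₁) hle₁
      have := hdim e C hC0 (hC ▸ le_sup_right)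
      have := h.pos e
      have := h.upper e
      omega
    rw [hC0, sup_bot_eq] at hC
    have h1 := K0.cls_sup hd
    have h2 : K0.cls E ↥(V ⊔ V₁) ∈ H := by
      rw [K0.cls_congr (LinearEquiv.ofEq _ _ hC)]
      exact hH e
    rw [h1] at h2
    exact (H.add_mem_cancel_right hmem).mp h2
  have hstep : ∀ f e, r f e →
      (∀ V : Ideal E, IsSimpleModule E V → V ≤ Ideal.span {ε f} → K0.cls E V ∈ H) →
      ∀ V : Ideal E, IsSimpleModule E V → V ≤ Ideal.span {ε e} → K0.cls E V ∈ H := by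
    intro f e hfe hf
    rcases h.linked e with he | he
    · exact hsmall e he
    obtain ⟨a, ha⟩ := he f hfe
    -- A simple `V₁` inside the left ideal of the link lies in `E ε e` and is not killed by `ε f`,
    -- so it is isomorphic to a summand of `E ε f`.
    rcases IsSemisimpleModule.eq_bot_or_exists_simple_le (Ideal.span {ε f * a * ε e}) with
      h0 | ⟨V₁, hV₁, hV₁s⟩
    · exact absurd (Ideal.span_singleton_eq_bot.mp h0) ha
    · refine hlarge e V₁ hV₁s (hV₁.trans ?_) ?_
      · rw [Ideal.span_singleton_le_iff_mem]
        exact Ideal.mul_mem_left _ _ (Ideal.mem_span_singleton_self _)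
      · obtain ⟨x, hx, hfx, hx0⟩ := Ideal.exists_mul_eq_self_of_le_span (ε := ε f)
          (by rw [← mul_assoc, ← mul_assoc, (h.idem f).eq]) (hne V₁ hV₁s) hV₁
        obtain ⟨V, hV, hVs, ⟨e'⟩⟩ := Ideal.exists_simple_le_span_linearEquiv (ε := ε f)
          (s := (⟨x, hx⟩ : V₁)) (Subtype.ext hfx) (fun h0 => hx0 (congrArg Subtype.val h0))
        rw [← K0.cls_congr e']
        exact hf V hVs hV
  have hall : ∀ e, ∀ V : Ideal E, IsSimpleModule E V → V ≤ Ideal.span {ε e} → K0.cls E V ∈ H := by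
    intro e
    obtain ⟨e₀, he₀⟩ := h.exists_small
    induction h.connected e₀ e with
    | refl => exact hsmall e₀ he₀
    | tail _ hbc ih => exact hstep _ _ hbc ih
  refine K0.cls_mem_of_forall_isSimpleModule fun S _ _ _ => ?_
  have := IsSimpleModule.nontrivial E S
  obtain ⟨s, hs⟩ := exists_ne (0 : S)
  have hex : ∃ e a, (ε e * a) • s ≠ 0 := by
    by_contra! H0
    have := h.generate (LinearMap.ker (LinearMap.toSpanSingleton E S s)) H0
    rw [Ideal.eq_top_iff_one] at this
    exact hs (by simpa using this)
  obtain ⟨e, a, hea⟩ := hex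
  obtain ⟨V, hV, hVs, ⟨e'⟩⟩ := Ideal.exists_simple_le_span_linearEquiv (ε := ε e)
    (s := (ε e * a) • s) (by rw [smul_smul, ← mul_assoc, (h.idem e).eq]) hea
  rw [← K0.cls_congr e']
  exact hall e V hVs hV

theorem PeirceBounds.rank_K0_le [Fintype ι] [DecidablePred fun e => ε e ≠ 0]
    (h : PeirceBounds K ε δ r) :
    Module.rank ℤ (K0 E) ≤ (Finset.univ.filter fun e => ε e ≠ 0).card := by
  classical
  let s : Finset (K0 E) := (Finset.univ.filter fun e => ε e ≠ 0).image
    fun e => K0.cls E (Ideal.span {ε e})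
  have hs : Submodule.span ℤ (s : Set (K0 E)) = ⊤ := by
    have := h.addSubgroup_eq_top (H := (Submodule.span ℤ (s : Set (K0 E))).toAddSubgroup) (by
      intro e
      by_cases he : ε e = 0
      · have : Subsingleton (Ideal.span {ε e}) := by
          rw [he, Ideal.span_singleton_zero]; infer_instance
        rw [K0.cls_eq_zero]
        exact AddSubgroup.zero_mem _
      · exact Submodule.subset_span (Finset.mem_coe.mpr (Finset.mem_image_of_mem _
          (Finset.mem_filter.mpr ⟨Finset.mem_univ e, he⟩))))
    rw [eq_top_iff]
    intro z _
    have hz : z ∈ (Submodule.span ℤ (s : Set (K0 E))).toAddSubgroup := this ▸ trivial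
    exact hz
  have h1 := rank_span_finset_le (R := ℤ) s
  rw [hs, rank_top] at h1
  exact h1.trans (by exact_mod_cast Finset.card_image_le)

end SemisimpleK0

/-! ### A lower bound for the rank of `K₀` -/

section RankLowerBound

variable {k : Type*} {A : Type u} [Field k] [Ring A] [Algebra k A]

theorem Module.Finite.linearMap_of_finite (k : Type*) {A : Type*} [Field k] [Ring A] [Algebra k A]
    {P N : Type*} [AddCommGroup P] [Module A P] [Module.Finite A P] [AddCommGroup N] [Module A N]
    [Module k N] [IsScalarTower k A N] [Module.Finite k N] : Module.Finite k (P →ₗ[A] N) := by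
  obtain ⟨s, hs⟩ := Module.Finite.fg_top (R := A) (M := P)
  let ev : (P →ₗ[A] N) →ₗ[k] (s → N) :=
    { toFun := fun f i => f i, map_add' := fun _ _ => rfl, map_smul' := fun _ _ => rfl }
  refine Module.Finite.of_injective ev fun f g hfg => LinearMap.ext_on hs fun x hx => ?_
  exact congrFun hfg ⟨x, hx⟩

/-- The homomorphism `[P] ↦ dim Hom(P, N)` from `K₀`. -/
noncomputable def K0.dimHom (k : Type*) {A : Type u} [Field k] [Ring A] [Algebra k A]
    (N : Type*) [AddCommGroup N] [Module A N]
    [Module k N] [IsScalarTower k A N] [Module.Finite k N] : K0 A →+ ℤ :=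
  QuotientAddGroup.lift (K0Relations A)
    (FreeAbelianGroup.lift fun P => (Module.finrank k (P.carrier →ₗ[A] N) : ℤ)) (by
      refine (AddSubgroup.closure_le _).mpr ?_
      rintro _ ⟨P, Q, Q', ⟨e⟩, rfl⟩
      have := Module.Finite.linearMap_of_finite k (A := A) (P := Q.carrier) (N := N)
      have := Module.Finite.linearMap_of_finite k (A := A) (P := Q'.carrier) (N := N)
      have e' : (P.carrier →ₗ[A] N) ≃ₗ[k] (Q.carrier →ₗ[A] N) × (Q'.carrier →ₗ[A] N) :=
        ((LinearMap.coprodEquiv (M := Q.carrier) (M₂ := Q'.carrier) (M₃ := N) k (R := A)).trans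
          (LinearEquiv.congrLeft N k e.symm)).symm
      simp [e'.finrank_eq])

theorem K0.dimHom_cls (N : Type*) [AddCommGroup N] [Module A N]
    [Module k N] [IsScalarTower k A N] [Module.Finite k N] (P : Type u) [AddCommGroup P]
    [Module A P] [Module.Finite A P] [Module.Projective A P] :
    K0.dimHom k N (K0.cls A P) = Module.finrank k (P →ₗ[A] N) := by
  exact FreeAbelianGroup.lift_apply_of _ _

theorem IsIdempotentElem.projective_span {e : A} (he : IsIdempotentElem e) :
    Module.Projective A (Ideal.span {e}) := by
  refine Module.Projective.of_split (Ideal.span {e}).subtype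
    ((LinearMap.toSpanSingleton A A e).codRestrict (Ideal.span {e})
      fun a => Ideal.mul_mem_left _ a (Ideal.mem_span_singleton_self e)) ?_
  ext ⟨x, hx⟩
  exact he.mem_span_singleton_iff.mp hx

/-- The matrix of dimensions of `Hom(A j e, A / m f)` is diagonal with nonzero diagonal entries,
which forces the classes of the `A j e` to be independent. -/
theorem K0.card_le_rank [Module.Finite k A] {ι : Type*} [Fintype ι] {j : ι → A}
    (hj : ∀ e, IsIdempotentElem (j e)) (m : ι → Ideal A) (hmem : ∀ e f, e ≠ f → ∀ a, j e * a ∈ m f)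
    (hnot : ∀ e, j e ∉ m e) : (Fintype.card ι : Cardinal) ≤ Module.rank ℤ (K0 A) := by
  classical
  have hproj := fun e => (hj e).projective_span
  have hfin : ∀ e, Module.Finite k (A ⧸ m e) := fun e =>
    Module.Finite.of_surjective ((m e).mkQ.restrictScalars k) (m e).mkQ_surjective
  let c : ι → K0 A := fun e => K0.cls A (Ideal.span {j e})
  have hne : ∀ e f, e ≠ f → K0.dimHom k (A ⧸ m f) (c e) = 0 := by
    intro e f hef
    rw [K0.dimHom_cls]
    have : Subsingleton (Ideal.span {j e} →ₗ[A] A ⧸ m f) := by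
      refine subsingleton_of_forall_eq 0 fun g => ?_
      ext ⟨x, hx⟩
      obtain ⟨y, hy⟩ := (m f).mkQ_surjective (g ⟨j e, Ideal.mem_span_singleton_self _⟩)
      have h1 : g ⟨j e, Ideal.mem_span_singleton_self _⟩ = 0 := by
        have h2 : (⟨j e, Ideal.mem_span_singleton_self _⟩ : Ideal.span {j e}) =
          j e • ⟨j e, Ideal.mem_span_singleton_self _⟩ := Subtype.ext (hj e).eq.symm
        rw [h2, map_smul, ← hy, ← map_smul]
        exact (Submodule.Quotient.mk_eq_zero _).mpr (hmem e f hef y)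
      have h3 : (⟨x, hx⟩ : Ideal.span {j e}) = x • ⟨j e, Ideal.mem_span_singleton_self _⟩ :=
        Subtype.ext ((hj e).mem_span_singleton_iff.mp hx).symm
      rw [h3, map_smul, h1, smul_zero, LinearMap.zero_apply]
    exact_mod_cast Module.finrank_zero_of_subsingleton
  have hself : ∀ e, K0.dimHom k (A ⧸ m e) (c e) ≠ 0 := by
    intro e
    rw [K0.dimHom_cls]
    have := Module.Finite.linearMap_of_finite k (A := A) (P := Ideal.span {j e}) (N := A ⧸ m e)
    have : Nontrivial (Ideal.span {j e} →ₗ[A] A ⧸ m e) := by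
      refine ⟨(m e).mkQ ∘ₗ (Ideal.span {j e}).subtype, 0, fun h0 => hnot e ?_⟩
      have := LinearMap.congr_fun h0 ⟨j e, Ideal.mem_span_singleton_self _⟩
      exact (Submodule.Quotient.mk_eq_zero _).mp this
    exact_mod_cast Module.finrank_pos.ne'
  have hli : LinearIndependent ℤ c := by
    rw [Fintype.linearIndependent_iff]
    intro g hg f
    have h1 := congrArg (K0.dimHom k (A ⧸ m f)) hg
    rw [map_sum, map_zero, Finset.sum_eq_single f] at h1
    · rw [map_zsmul, smul_eq_mul] at h1
      exact (mul_eq_zero.mp h1).resolve_right (hself f)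
    · intro e _ hef
      rw [map_zsmul, hne e f hef, smul_zero]
    · simp
  simpa using hli.cardinal_lift_le_rank

end RankLowerBound

/-! ### Projective covers of simple modules -/

section ProjCover

variable {B : Type*} [Ring B] {P S : Type*} [AddCommGroup P] [Module B P] [AddCommGroup S]
  [Module B S] [IsSimpleModule B S] {π : P →ₗ[B] S}

/-- The kernel is both maximal and superfluous, hence the greatest proper submodule. -/
theorem IsProjCover.le_ker (h : IsProjCover π) {N : Submodule B P} (hN : N ≠ ⊤) :
    N ≤ LinearMap.ker π := by
  by_contra hle
  have hc := LinearMap.isCoatom_ker_of_surjective h.surjective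
  exact hN (h.superfluous N (hc.2 _ (right_lt_sup.mpr hle)))

theorem IsProjCover.jacobson_eq_ker (h : IsProjCover π) :
    Module.jacobson B P = LinearMap.ker π :=
  le_antisymm (sInf_le (LinearMap.isCoatom_ker_of_surjective h.surjective))
    (le_sInf fun N hN => by
      have hle := h.le_ker hN.1
      rcases hN.le_iff.mp hle with h1 | h1
      · exact absurd h1 (LinearMap.isCoatom_ker_of_surjective h.surjective).1
      · exact h1.le)

/-- The projective cover `P` of a simple module is generated by an element `x`, and the surjection
`b ↦ b x` from the ring to `P` has a section. -/
theorem IsProjCover.exists_generator (h : IsProjCover π) :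
    ∃ (x : P) (t : P →ₗ[B] B), (∀ p, t p • x = p) ∧ π x ≠ 0 := by
  have := IsSimpleModule.nontrivial B S
  obtain ⟨s, hs⟩ := exists_ne (0 : S)
  obtain ⟨x, rfl⟩ := h.surjective s
  have hx : Submodule.span B {x} = ⊤ := by
    by_contra hne
    exact hs (h.le_ker hne (Submodule.mem_span_singleton_self x))
  have hsurj : Function.Surjective (LinearMap.toSpanSingleton B P x) := by
    rw [← LinearMap.range_eq_top, LinearMap.range_toSpanSingleton, hx]
  have := h.projective
  obtain ⟨t, ht⟩ := Module.projective_lifting_property _ LinearMap.id hsurj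
  exact ⟨x, t, fun p => LinearMap.congr_fun ht p, hs⟩

variable {x : P} {t : P →ₗ[B] B}

theorem LinearMap.mul_apply_eq (t : P →ₗ[B] B) (x : P) (b : B) : b * t x = t (b • x) := by
  rw [map_smul, smul_eq_mul]

theorem isIdempotentElem_of_generator (ht : ∀ p, t p • x = p) : IsIdempotentElem (t x) := by
  rw [IsIdempotentElem, t.mul_apply_eq, ht]

/-- An idempotent defining the projective cover of a simple module acts as zero on the other simple
modules. -/
theorem IsProjCover.linearEquiv_of_smul_ne_zero (h : IsProjCover π)
    {S' : Type*} [AddCommGroup S'] [Module B S'] [IsSimpleModule B S'] {s : S'}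
    (hs : t x • s ≠ 0) : Nonempty (S ≃ₗ[B] S') := by
  let f : P →ₗ[B] S' := LinearMap.toSpanSingleton B S' s ∘ₗ t
  have hf : f ≠ 0 := fun h0 => hs (LinearMap.congr_fun h0 x)
  have hsurj := LinearMap.surjective_of_ne_zero hf
  have hker : LinearMap.ker π = LinearMap.ker f := by
    have hc := LinearMap.isCoatom_ker_of_surjective hsurj
    rcases hc.le_iff.mp (h.le_ker hc.1) with h1 | h1
    · exact absurd h1 (LinearMap.isCoatom_ker_of_surjective h.surjective).1
    · exact h1
  exact ⟨(π.quotKerEquivOfSurjective h.surjective).symm.trans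
    ((Submodule.quotEquivOfEq _ _ hker).trans (f.quotKerEquivOfSurjective hsurj))⟩

end ProjCover

theorem Module.isSemisimpleModule_soc (B M : Type*) [Ring B] [AddCommGroup M] [Module B M] :
    IsSemisimpleModule B (Module.soc B M) := by
  rw [Module.soc, sSup_eq_iSup]
  exact isSemisimpleModule_biSup_of_isSemisimpleModule_submodule fun N hN => by
    have : IsSimpleModule B N := hN
    infer_instance

/-! ### The size of the corner algebra of a projective cover -/

section Bound

variable {k : Type*} {B : Type*} [Field k] [Ring B] [Algebra k B]
variable {P S : Type*} [AddCommGroup P] [Module B P] [AddCommGroup S]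
  [Module B S] {π : P →ₗ[B] S} {x : P} {t : P →ₗ[B] B}

/-- The elements of `i B i` which act as zero on the image of the generator in the top. -/
def topKer (k : Type*) {B : Type*} [Field k] [Ring B] [Algebra k B] {P S : Type*}
    [AddCommGroup P] [Module B P] [AddCommGroup S] [Module B S] (π : P →ₗ[B] S) (x : P)
    (t : P →ₗ[B] B) : Submodule k ((Ideal.span {t x}).leftPart k (t x)) :=
  ((LinearMap.ker (LinearMap.toSpanSingleton B S (π x))).restrictScalars k).comap
    ((Ideal.span {t x}).leftPart k (t x)).subtype

theorem mem_topKer {y : (Ideal.span {t x}).leftPart k (t x)} :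
    y ∈ topKer k π x t ↔ (y : B) • π x = 0 := Iff.rfl

theorem finrank_topKer_lt [Module.Finite k B] (ht : ∀ p, t p • x = p) (hx : π x ≠ 0) :
    Module.finrank k (topKer k π x t) <
      Module.finrank k ((Ideal.span {t x}).leftPart k (t x)) := by
  refine Submodule.finrank_lt (fun htop => hx ?_)
  have h1 : (⟨t x, Ideal.mem_span_singleton_self _, isIdempotentElem_of_generator ht⟩ :
      (Ideal.span {t x}).leftPart k (t x)) ∈ topKer k π x t := htop ▸ trivial
  rw [mem_topKer, ← map_smul, ht] at h1
  exact h1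

/-- With `i = t x`, the submodule `(X ∩ B i) x` of `P` is proper, since `b x = x` with `b ∈ X ∩ B i`
would give `b = i ∈ X`. So it lies in the kernel of `π`. -/
theorem IsProjCover.mem_topKer_of_mem [IsSimpleModule B S] (h : IsProjCover π)
    (ht : ∀ p, t p • x = p) {X : Ideal B} (hX : t x ∉ X)
    {y : (Ideal.span {t x}).leftPart k (t x)} (hy : (y : B) ∈ X) : y ∈ topKer k π x t := by
  have hi := isIdempotentElem_of_generator ht
  have hne : Submodule.map (LinearMap.toSpanSingleton B P x) (X ⊓ Ideal.span {t x}) ≠ ⊤ := by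
    intro htop
    have hx : x ∈ Submodule.map (LinearMap.toSpanSingleton B P x) (X ⊓ Ideal.span {t x}) :=
      htop ▸ trivial
    obtain ⟨b, ⟨hb, hb'⟩, hbx⟩ := hx
    have h1 : b * t x = t x := by
      rw [t.mul_apply_eq]
      exact congrArg t hbx
    rw [hi.mem_span_singleton_iff.mp hb'] at h1
    exact hX (h1 ▸ hb)
  have h2 := h.le_ker hne ⟨(y : B), ⟨hy, y.2.1⟩, rfl⟩
  rw [mem_topKer, ← map_smul]
  exact h2

/-- As `i = t x` kills the heart, `J = topKer` sends `x` into the socle, and therefore `J * J = 0`.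
The symmetrizing form on `i B i` then makes `J` totally isotropic, so `J` has at most half the
dimension. -/
theorem finrank_leftPart_le_of_heart [Module.Finite k B] [IsSimpleModule B S] (h : IsProjCover π)
    (ht : ∀ p, t p • x = p) (hsymm : IsSymmetricAlg k B)
    (hheart : ∀ m : Module.Heart B P, t x • m = 0) :
    Module.finrank k ((Ideal.span {t x}).leftPart k (t x)) ≤
      2 * (Module.finrank k ((Ideal.span {t x}).leftPart k (t x)) -
        Module.finrank k (topKer k π x t)) := by
  obtain ⟨l, hl, hl0⟩ := hsymm
  have hi := isIdempotentElem_of_generator ht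
  have hsoc : ∀ y ∈ topKer k π x t, (y : B) • x ∈ Module.soc B P := by
    intro y hy
    have h1 : (y : B) • x ∈ Module.jacobson B P := by
      rw [h.jacobson_eq_ker, LinearMap.mem_ker, map_smul]
      exact hy
    have h2 := hheart (Submodule.Quotient.mk ⟨(y : B) • x, h1⟩)
    rw [← Submodule.Quotient.mk_smul, Submodule.Quotient.mk_eq_zero] at h2
    have h3 : t x • (y : B) • x ∈ Module.soc B P := h2
    rwa [smul_smul, y.2.2] at h3
  have hmul : ∀ y ∈ topKer k π x t, ∀ z ∈ topKer k π x t, (y : B) * (z : B) = 0 := by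
    intro y hy z hz
    let ρ : P →ₗ[B] Module.soc B P :=
      LinearMap.toSpanSingleton B (Module.soc B P) ⟨(z : B) • x, hsoc z hz⟩ ∘ₗ t
    have := Module.isSemisimpleModule_soc B P
    -- Module maps preserve radicals, and the socle, being semisimple, has radical zero.
    have h1 : ρ ((y : B) • x) ∈ Module.jacobson B (Module.soc B P) := by
      refine Module.map_jacobson_le ρ ⟨(y : B) • x, ?_, rfl⟩
      rw [h.jacobson_eq_ker]
      exact (map_smul π _ _).trans hy
    rw [IsSemisimpleModule.jacobson_eq_bot, Submodule.mem_bot] at h1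
    have h2 : t ((y : B) • x) • (z : B) • x = 0 := congrArg Subtype.val h1
    rw [← t.mul_apply_eq, hi.mem_span_singleton_iff.mp y.2.1, smul_smul] at h2
    have h3 := t.mul_apply_eq x ((y : B) * (z : B))
    rwa [h2, map_zero, mul_assoc, hi.mem_span_singleton_iff.mp z.2.1] at h3
  let L := (Ideal.span {t x}).leftPart k (t x)
  let J : Submodule k L := topKer k π x t
  let β : L →ₗ[k] Module.Dual k L :=
    { toFun := fun z => l ∘ₗ LinearMap.mulRight k (z : B) ∘ₗ L.subtype
      map_add' := fun a b => by ext; simp [mul_add]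
      map_smul' := fun a b => by ext; simp }
  -- Nondegeneracy descends to the corner, because `l (z * b) = l ((i * b * i) * z)` for `z` in `i B
  -- i`.
  have hβ : Function.Injective β := by
    rw [injective_iff_map_eq_zero]
    intro z hz
    refine Subtype.ext (hl0 z fun b => ?_)
    have hiz : t x * (z : B) = z := z.2.2
    have hzi : (z : B) * t x = z := hi.mem_span_singleton_iff.mp z.2.1
    have h1 : l ((t x * b * t x) * (z : B)) = 0 := LinearMap.congr_fun hz
      ⟨t x * b * t x, Ideal.mul_mem_left _ _ (Ideal.mem_span_singleton_self _), by
        rw [← mul_assoc, ← mul_assoc, hi.eq]⟩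
    rw [mul_assoc (t x * b), hiz, mul_assoc, hl, mul_assoc, hzi, hl] at h1
    exact h1
  have hle : J.map β ≤ J.dualAnnihilator := by
    rintro _ ⟨z, hz, rfl⟩
    rw [Submodule.mem_dualAnnihilator]
    intro y hy
    change l ((y : B) * (z : B)) = 0
    rw [hmul y hy z hz, map_zero]
  have h1 := Submodule.finrank_mono hle
  rw [← (Submodule.equivMapOfInjective β hβ J).finrank_eq] at h1
  have h2 := Subspace.finrank_add_finrank_dualAnnihilator_eq J
  change Module.finrank k L ≤ 2 * (Module.finrank k L - Module.finrank k J)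
  omega

end Bound

/-! ### The combinatorics of stems -/

namespace BrauerTree

variable {V : Type x} [Finite V] (Γ : BrauerTree V)

theorem rotate_eq_of_subsingleton {v : V} (h : (Γ.graph.incidenceSet v).ncard = 1) (e : Γ.Edge)
    (hv : v ∈ (e : Sym2 V)) (i : ℕ) : Γ.rotate v e hv i = e := by
  obtain ⟨a, ha⟩ := Set.ncard_eq_one.mp h
  have h1 : ∀ f : Γ.graph.incidenceSet v, (f : Sym2 V) = a := fun f =>
    Set.mem_singleton_iff.mp (ha.subset f.2)
  exact Subtype.ext ((h1 _).trans (h1 ⟨e.1, e.2, hv⟩).symm)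

theorem rotate_ne_of_ncard_eq_two {v : V} (h : (Γ.graph.incidenceSet v).ncard = 2) (e : Γ.Edge)
    (hv : v ∈ (e : Sym2 V)) : Γ.rotate v e hv 1 ≠ e := by
  intro heq
  let e' : Γ.graph.incidenceSet v := ⟨e.1, e.2, hv⟩
  have hfix : Γ.perm v e' = e' := Subtype.ext (congrArg (fun z : Γ.Edge => (z : Sym2 V)) heq)
  obtain ⟨f, hf, hfe⟩ := Set.exists_ne_of_one_lt_ncard
    (h ▸ one_lt_two : 1 < (Γ.graph.incidenceSet v).ncard)
     (e : Sym2 V)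
  obtain ⟨n, hn⟩ := Γ.perm_transitive v e' ⟨f, hf⟩
  have h1 : ((Γ.perm v) ^ n) e' = e' := Function.IsFixedPt.perm_zpow hfix n
  rw [h1] at hn
  exact hfe (congrArg Subtype.val hn).symm

/-- The relation `f = σ_v(e) ≠ e` between edges. -/
def IsRotation (f e : Γ.Edge) : Prop :=
  ∃ (v : V) (hv : v ∈ (e : Sym2 V)), Γ.rotate v e hv 1 = f ∧ f ≠ e

theorem reflTransGen_isRotation_of_mem {v : V} {e f : Γ.Edge} (he : v ∈ (e : Sym2 V))
    (hf : v ∈ (f : Sym2 V)) : Relation.ReflTransGen Γ.IsRotation e f := by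
  -- The relation points from `σ_v(f)` to `f`, so the chain descends through powers of `σ_v`; a
  -- fixed edge contributes no step.
  have key : ∀ (n : ℕ) (e f : Γ.graph.incidenceSet v), ((Γ.perm v) ^ n) f = e →
      Relation.ReflTransGen Γ.IsRotation ⟨e.1, e.2.1⟩ ⟨f.1, f.2.1⟩ := by
    intro n
    induction n with
    | zero => rintro e f rfl; exact .refl
    | succ n ih =>
      rintro e f hef
      have h1 := ih e (Γ.perm v f) (by rw [← hef, pow_succ, Equiv.Perm.mul_apply])
      by_cases hfix : Γ.perm v f = f
      · rwa [hfix] at h1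
      · exact h1.tail ⟨v, f.2.2, rfl, fun h0 => hfix (
            Subtype.ext (congrArg (fun z : Γ.Edge => (z : Sym2 V)) h0))⟩
  obtain ⟨n, hn⟩ := (Γ.perm_transitive v ⟨f.1, f.2, hf⟩ ⟨e.1, e.2, he⟩).exists_nat_pow_eq
  exact key n ⟨e.1, e.2, he⟩ ⟨f.1, f.2, hf⟩ hn

/-- Consecutive edges of a walk from a vertex of `e` to a vertex of `f` share a vertex. -/
theorem reflTransGen_isRotation (e f : Γ.Edge) : Relation.ReflTransGen Γ.IsRotation e f := by
  have key : ∀ (a b : V) (p : Γ.graph.Walk a b) (e f : Γ.Edge), a ∈ (e : Sym2 V) →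
      b ∈ (f : Sym2 V) → Relation.ReflTransGen Γ.IsRotation e f := by
    intro a b p
    induction p with
    | nil => exact fun e f he hf => Γ.reflTransGen_isRotation_of_mem he hf
    | @cons a b c hab p ih =>
      intro e f he hf
      let g : Γ.Edge := ⟨s(a, b), hab⟩
      exact (Γ.reflTransGen_isRotation_of_mem he (Sym2.mem_mk_left a b : a ∈ (g : Sym2 V))).trans
        (ih g f (Sym2.mem_mk_right a b) hf)
  obtain ⟨p⟩ := Γ.isTree.connected.preconnected (e : Sym2 V).out.1 (f : Sym2 V).out.1
  exact key _ _ p e f (Sym2.out_fst_mem _) (Sym2.out_fst_mem _)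

variable {Γ}

theorem multAt_eq_one (h : Γ.NoExceptionalVertex) (v : V) : Γ.multAt v = 1 := by
  classical
  unfold multAt
  rw [h]
  simp

theorem ncard_incidenceSet_eq (h : Γ.IsStem) {v : V} {e : Γ.Edge} (hv : v ∈ (e : Sym2 V)) :
    (Γ.graph.incidenceSet v).ncard = 1 ∨ (Γ.graph.incidenceSet v).ncard = 2 := by
  have h1 := h v
  have h2 : 0 < (Γ.graph.incidenceSet v).ncard :=
    (Set.ncard_pos (Set.toFinite _)).mpr ⟨e.1, e.2, hv⟩
  omega

/-! ### Brauer tree algebras of stems -/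

section

variable {B : Type v} [Ring B] {S : Γ.Edge → ModuleCat.{v} B} {e : Γ.Edge} {P : ModuleCat.{v} B}
  {U : V → Submodule B (Module.Heart B P)}

/-- The composition length is `1 * 2 - 1 = 1`, so `U v` is simple and equals its layer of index 0.
-/
theorem HasShape.layer_zero (hexc : Γ.NoExceptionalVertex)
    (h : Γ.HasShape B S e P U) {v : V} (hv : v ∈ (e : Sym2 V))
    (h2 : (Γ.graph.incidenceSet v).ncard = 2) : Nonempty (U v ≃ₗ[B] S (Γ.rotate v e hv 1)) := by
  have hlen := h.length v hv
  rw [multAt_eq_one hexc, h2] at hlen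
  have hsimple : IsSimpleModule B (U v) := Module.length_eq_one_iff.mp (by simpa using hlen)
  have hrad : ((U v).radPow 1).comap ((U v).radPow 0).subtype = ⊥ := by
    have h1 : (U v).radPow 1 = ⊥ :=
      (congrArg (Submodule.map (U v).subtype) (IsSemisimpleModule.jacobson_eq_bot B (U v))).trans
        (Submodule.map_bot _)
    rw [h1]
    exact LinearMap.ker_eq_bot.mpr Subtype.val_injective
  let q : (U v).RadLayer 0 ≃ₗ[B] U v := Submodule.quotEquivOfEqBot _ hrad
  have : Nontrivial (U v) := IsSimpleModule.nontrivial B (U v)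
  obtain ⟨g⟩ := h.layer v hv 0 q.toEquiv.nontrivial
  exact ⟨q.symm.trans g⟩

/-- At a vertex of valency 1 the summand `U v` vanishes; at valency 2 it is the simple module of the
other edge. -/
theorem HasShape.smul_heart_eq_zero (hstem : Γ.IsStem) (hexc : Γ.NoExceptionalVertex)
    (h : Γ.HasShape B S e P U) {b : B} (hb : ∀ f, f ≠ e → ∀ s : S f, b • s = 0)
    (m : Module.Heart B P) : b • m = 0 := by
  have hU : ∀ v ∈ (e : Sym2 V), ∀ y ∈ U v, b • y = 0 := by
    intro v hv y hy
    rcases ncard_incidenceSet_eq hstem hv with h1 | h2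
    · have hlen := h.length v hv
      rw [multAt_eq_one hexc, h1] at hlen
      have : Subsingleton (U v) := Module.length_eq_zero_iff.mp (by simpa using hlen)
      have hy0 : (⟨y, hy⟩ : U v) = 0 := Subsingleton.elim _ _
      rw [show y = 0 from congrArg Subtype.val hy0, smul_zero]
    · obtain ⟨g⟩ := h.layer_zero hexc hv h2
      have h3 : b • (⟨y, hy⟩ : U v) = 0 := by
        apply g.injective
        rw [map_smul, map_zero]
        exact hb _ (Γ.rotate_ne_of_ncard_eq_two h2 e hv) _
      exact congrArg Subtype.val h3
  obtain ⟨a, c, hac⟩ : ∃ a c, (e : Sym2 V) = s(a, c) :=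
    ⟨_, _, (Quot.out_eq (e : Sym2 V)).symm⟩
  have htop := (h.isCompl a c hac).sup_eq_top
  obtain ⟨y, hy, z, hz, rfl⟩ := Submodule.mem_sup.mp (htop ▸ trivial : m ∈ U a ⊔ U c)
  rw [smul_add, hU a (hac ▸ Sym2.mem_mk_left a c) y hy,
    hU c (hac ▸ Sym2.mem_mk_right a c) z hz, add_zero]

theorem HasShape.exists_smul_ne_zero (hstem : Γ.IsStem) (hexc : Γ.NoExceptionalVertex)
    (h : Γ.HasShape B S e P U) {f : Γ.Edge} (hf : Γ.IsRotation f e) {b : B} {s : S f}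
    (hb : b • s ≠ 0) : ∃ p : P, b • p ≠ 0 := by
  obtain ⟨v, hv, rfl, hne⟩ := hf
  rcases ncard_incidenceSet_eq hstem hv with h1 | h2
  · exact absurd (Γ.rotate_eq_of_subsingleton h1 e hv 1) hne
  obtain ⟨g⟩ := h.layer_zero hexc hv h2
  obtain ⟨⟨m, hm⟩, rfl⟩ := g.surjective s
  obtain ⟨p, rfl⟩ := Submodule.Quotient.mk_surjective _ m
  refine ⟨p, fun hp => hb ?_⟩
  have hp' : b • p = 0 := Subtype.ext hp
  rw [← map_smul]
  refine (congrArg g (Subtype.ext ?_)).trans (map_zero g)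
  change b • Submodule.Quotient.mk p = 0
  rw [← Submodule.Quotient.mk_smul, hp', Submodule.Quotient.mk_zero]

end

end BrauerTree

variable {k : Type u} {B : Type v} [Field k] [Ring B] [Algebra k B] {V : Type x} [Finite V]
  {Γ : BrauerTree V}

/-- Beyond finiteness, symmetry and the connectedness of the tree, this is all that the argument
needs to know about `B`. -/
theorem IsBrauerTreeAlgebra.exists_idempotents (hstem : Γ.IsStem) (hexc : Γ.NoExceptionalVertex)
    (hB : IsBrauerTreeAlgebra k B Γ) :
    ∃ (i : Γ.Edge → B) (J : ∀ e, Submodule k ((Ideal.span {i e}).leftPart k (i e))),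
      (∀ e, IsIdempotentElem (i e)) ∧
      (∀ e, Module.finrank k (J e) < Module.finrank k ((Ideal.span {i e}).leftPart k (i e))) ∧
      (∀ m : Ideal B, m.IsMaximal → ∃ e, (∃ b, i e * b ∉ m) ∧ ∀ f, f ≠ e → ∀ b, i f * b ∈ m) ∧
      (∀ (e : Γ.Edge) (X : Ideal B), i e ∉ X →
        ∀ y : (Ideal.span {i e}).leftPart k (i e), (y : B) ∈ X → y ∈ J e) ∧
      (∀ e, Module.finrank k ((Ideal.span {i e}).leftPart k (i e)) ≤
        2 * (Module.finrank k ((Ideal.span {i e}).leftPart k (i e)) - Module.finrank k (J e))) ∧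
      (∀ e f, Γ.IsRotation f e → ∃ b, i f * b * i e ≠ 0) := by
  have := hB.finite
  obtain ⟨S, hS, hinj, hclass, hP⟩ := hB.shape
  choose P π U hπ hU using hP
  choose x t ht hx using fun e => (hπ e).exists_generator
  have hself : ∀ e, t e (x e) • π e (x e) ≠ 0 := fun e => by
    rw [← map_smul, ht]; exact hx e
  have hother : ∀ e f, e ≠ f → ∀ s : S f, t e (x e) • s = 0 := by
    intro e f hef s
    by_contra hs
    exact hef (hinj e f ((hπ e).linearEquiv_of_smul_ne_zero hs))
  refine ⟨fun e => t e (x e), fun e => topKer k (π e) (x e) (t e),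
    fun e => isIdempotentElem_of_generator (ht e), fun e => finrank_topKer_lt (ht e) (hx e), ?_,
    fun e X hX y hy => (hπ e).mem_topKer_of_mem (ht e) hX hy, fun e => ?_, ?_⟩
  · intro m hm
    have hsimple : IsSimpleModule B (B ⧸ m) := isSimpleModule_iff_isCoatom.mpr hm.out
    obtain ⟨e, ⟨g⟩⟩ := hclass (ModuleCat.of B (B ⧸ m)) hsimple
    refine ⟨e, ?_, fun f hf b => ?_⟩
    · obtain ⟨q, hq⟩ := g.surjective (π e (x e))
      obtain ⟨b, rfl⟩ := Submodule.Quotient.mk_surjective m q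
      refine ⟨b, fun hb => hself e ?_⟩
      rw [← hq, ← map_smul]
      refine (congrArg g ?_).trans (map_zero g)
      exact (Submodule.Quotient.mk_eq_zero m).mpr hb
    · have h1 := hother f e hf (g (Submodule.Quotient.mk b))
      rw [← map_smul] at h1
      exact (Submodule.Quotient.mk_eq_zero m).mp ((map_eq_zero_iff g g.injective).mp h1)
  · exact finrank_leftPart_le_of_heart (hπ e) (ht e) hB.symmetric
      fun m => (hU e).smul_heart_eq_zero hstem hexc (fun f hf => hother e f hf.symm) m
  · intro e f hfe
    obtain ⟨p, hp⟩ := (hU e).exists_smul_ne_zero hstem hexc hfe (hself f)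
    refine ⟨t e p, fun h0 => hp ?_⟩
    have h1 := congrArg (fun b => b • x e) h0
    simpa only [mul_smul, ht, zero_smul] using h1

/-! ### Peirce bounds for quotients by a nonzero ideal -/

section Quotient

variable {k : Type u} {B : Type v} [Field k] [Ring B] [Algebra k B] [Module.Finite k B]
  {ι : Type*} {i : ι → B} {J : ∀ e, Submodule k ((Ideal.span {i e}).leftPart k (i e))}
  {A : Type*} [Ring A] [Algebra k A] {ψ : B →ₐ[k] A}

/-- No maximal left ideal contains all the `i e * a`, so they generate the unit left ideal. -/
theorem eq_zero_of_forall_mul_eq_zero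
    (hmax : ∀ m : Ideal B, m.IsMaximal → ∃ e, ∃ b, i e * b ∉ m) {b : B}
    (hb : ∀ d e, b * d * i e = 0) : b = 0 := by
  have htop : Ideal.span {z | ∃ e a, z = i e * a} = ⊤ := by
    by_contra hne
    obtain ⟨m, hm, hle⟩ := Ideal.exists_le_maximal _ hne
    obtain ⟨e, a, ha⟩ := hmax m hm
    exact ha (hle (Ideal.subset_span ⟨e, a, rfl⟩))
  have h1 : (1 : B) ∈ Ideal.span {z | ∃ e a, z = i e * a} := htop ▸ trivial
  have key : ∀ z ∈ Ideal.span {z | ∃ e a, z = i e * a}, ∀ d, b * d * z = 0 := by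
    intro z hz
    induction hz using Submodule.span_induction with
    | mem z hz =>
      obtain ⟨e, a, rfl⟩ := hz
      intro d
      rw [← mul_assoc, hb, zero_mul]
    | zero => intro d; rw [mul_zero]
    | add y z _ _ hy hz => intro d; rw [mul_add, hy, hz, add_zero]
    | smul c z _ hz => intro d; rw [smul_eq_mul, ← mul_assoc, mul_assoc b, hz]
  simpa using key 1 h1 1

/-- A linear map on `i B i` with kernel contained in `J` has rank at least the codimension of `J`. -/
theorem sub_finrank_le_finrank_range {W : Type*} [AddCommGroup W] [Module k W] {e : ι}
    (Φ : (Ideal.span {i e}).leftPart k (i e) →ₗ[k] W) (hΦ : LinearMap.ker Φ ≤ J e) :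
    Module.finrank k ((Ideal.span {i e}).leftPart k (i e)) - Module.finrank k (J e) ≤
      Module.finrank k (LinearMap.range Φ) := by
  have h1 := LinearMap.finrank_range_add_finrank_ker Φ
  have h2 := Submodule.finrank_mono hΦ
  omega

/-- Right multiplication by a suitable element, as a map on `i e B i e`, has as kernel the trace of
a left ideal missing `i e`. The kernel lies in `J e`, and the image has dimension at least `δ e`.
This is applied in `A` for the lower bound and in the kernel of `ψ` to detect small edges. -/
theorem PeirceBounds.of_surjective [Module.Finite k A] {r : ι → ι → Prop}
    (hsymm : IsSymmetricAlg k B)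
    (hidem : ∀ e, IsIdempotentElem (i e))
    (hJ : ∀ e, Module.finrank k (J e) < Module.finrank k ((Ideal.span {i e}).leftPart k (i e)))
    (hmax : ∀ m : Ideal B, m.IsMaximal → ∃ e, ∃ b, i e * b ∉ m)
    (hlow : ∀ (e : ι) (X : Ideal B), i e ∉ X →
      ∀ y : (Ideal.span {i e}).leftPart k (i e), (y : B) ∈ X → y ∈ J e)
    (hup : ∀ e, Module.finrank k ((Ideal.span {i e}).leftPart k (i e)) ≤
      2 * (Module.finrank k ((Ideal.span {i e}).leftPart k (i e)) - Module.finrank k (J e)))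
    (hr : ∀ e f, r f e → ∃ b, i f * b * i e ≠ 0) (hconn : ∀ e f, Relation.ReflTransGen r e f)
    (hψ : Function.Surjective ψ) (hker : ∃ b, b ≠ 0 ∧ ψ b = 0) :
    PeirceBounds k (fun e => ψ (i e))
      (fun e => Module.finrank k ((Ideal.span {i e}).leftPart k (i e)) - Module.finrank k (J e))
      r := by
  obtain ⟨l, hl, hl0⟩ := hsymm
  have hmap : ∀ e, (Ideal.span {ψ (i e)}).leftPart k (ψ (i e)) ≤
      ((Ideal.span {i e}).leftPart k (i e)).map ψ.toLinearMap := by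
    rintro e z ⟨hz1, hz2⟩
    have hid : IsIdempotentElem (ψ (i e)) := by rw [IsIdempotentElem, ← map_mul, (hidem e).eq]
    rw [hid.mem_span_singleton_iff] at hz1
    obtain ⟨b, rfl⟩ := hψ z
    refine ⟨i e * b * i e, ⟨Ideal.mul_mem_left _ _ (Ideal.mem_span_singleton_self _), ?_⟩, ?_⟩
    · rw [← mul_assoc, ← mul_assoc, (hidem e).eq]
    · simp [hz1, hz2]
  have hsmall : ∀ e, (∃ b, b * i e = b ∧ b ≠ 0 ∧ ψ b = 0) →
      Module.finrank k ((Ideal.span {ψ (i e)}).leftPart k (ψ (i e))) ≤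
        Module.finrank k ((Ideal.span {i e}).leftPart k (i e)) - Module.finrank k (J e) := by
    rintro e ⟨b, hbe, hb0, hψb⟩
    -- Symmetry moves `b` from `B i e` into the corner: `l (b * c)` is the value of `l` at `i e * c
    -- * b`.
    obtain ⟨c, hc⟩ : ∃ c, i e * c * b ≠ 0 := by
      by_contra! H
      refine hb0 (hl0 b fun c => ?_)
      rw [hl, ← hbe, ← mul_assoc, hl, ← mul_assoc, H, map_zero]
    let L := (Ideal.span {i e}).leftPart k (i e)
    let Z : Submodule k L := LinearMap.ker (ψ.toLinearMap ∘ₗ L.subtype)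
    let Φ : L →ₗ[k] L := LinearMap.codRestrict L
      (LinearMap.mulRight k (i e * c * b) ∘ₗ L.subtype) fun y =>
        ⟨(hidem e).mem_span_singleton_iff.mpr (by
          change (y : B) * (i e * c * b) * i e = (y : B) * (i e * c * b)
          rw [mul_assoc, mul_assoc (i e * c), hbe]), by
          change i e * ((y : B) * (i e * c * b)) = (y : B) * (i e * c * b)
          rw [← mul_assoc, y.2.2]⟩
    have h1 := sub_finrank_le_finrank_range (J := J) Φ fun y hy =>
      hlow e (LinearMap.ker (LinearMap.toSpanSingleton B B (i e * c * b))) (fun h0 => hc (by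
        have h0' : i e * (i e * c * b) = 0 := h0
        rwa [← mul_assoc, ← mul_assoc, (hidem e).eq] at h0')) y (congrArg Subtype.val hy)
    -- The kernel of `ψ` on the corner thus has dimension at least `δ e`, and the total is at most
    -- `2 δ e`.
    have h2 : LinearMap.range Φ ≤ Z := by
      rintro _ ⟨y, rfl⟩
      change ψ ((y : B) * (i e * c * b)) = 0
      rw [map_mul, map_mul, hψb, mul_zero, mul_zero]
    have h3 := Submodule.finrank_mono h2
    have h4 := LinearMap.finrank_range_add_finrank_ker (ψ.toLinearMap ∘ₗ L.subtype)
    have h5 := Submodule.finrank_mono (hmap e)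
    rw [← Submodule.range_subtype ((Ideal.span {i e}).leftPart k (i e)), ← LinearMap.range_comp]
      at h5
    have h6 := hup e
    change Module.finrank k L - _ ≤ _ at h1
    change _ + Module.finrank k Z = Module.finrank k L at h4
    change Module.finrank k L ≤ 2 * (Module.finrank k L - _) at h6
    change _ ≤ Module.finrank k L - _
    change _ ≤ Module.finrank k (LinearMap.range (ψ.toLinearMap ∘ₗ L.subtype)) at h5
    omega
  refine ⟨fun e => ?_, fun e => Nat.sub_pos_of_lt (hJ e), ?_, ?_, fun e => ?_, fun e => ?_, ?_,
    hconn⟩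
  · rw [IsIdempotentElem, ← map_mul, (hidem e).eq]
  · intro N hN
    by_contra hne
    have hne' : N.comap ψ ≠ ⊤ := by
      rwa [Ne, Ideal.comap_eq_top_iff]
    obtain ⟨m, hm, hle⟩ := Ideal.exists_le_maximal _ hne'
    obtain ⟨e, b, hb⟩ := hmax m hm
    exact hb (hle (by rw [Ideal.mem_comap, map_mul]; exact hN e _))
  · intro N e a haN hea ha0
    let L := (Ideal.span {i e}).leftPart k (i e)
    let Φ : L →ₗ[k] A := LinearMap.mulRight k a ∘ₗ ψ.toLinearMap ∘ₗ L.subtype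
    refine (sub_finrank_le_finrank_range (J := J) Φ fun y hy =>
      hlow e (Ideal.comap ψ (LinearMap.ker (LinearMap.toSpanSingleton A A a))) (fun h0 => ha0 ?_)
        y hy).trans (Submodule.finrank_mono ?_)
    · have h0' : ψ (i e) * a = 0 := h0
      rw [← hea, h0']
    · rintro _ ⟨y, rfl⟩
      refine ⟨N.mul_mem_left _ haN, ?_⟩
      change ψ (i e) * (ψ y * a) = ψ y * a
      rw [← mul_assoc, ← map_mul, y.2.2]
  · exact ((Submodule.finrank_mono (hmap e)).trans (Submodule.finrank_map_le _ _)).trans (hup e)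
  -- If `ψ` is injective on `B i e`, the links present in `B` persist in `A`.
  · by_cases H : ∃ b, b * i e = b ∧ b ≠ 0 ∧ ψ b = 0
    · exact Or.inl (hsmall e H)
    · refine Or.inr fun f hf => ?_
      obtain ⟨b, hb⟩ := hr e f hf
      refine ⟨ψ b, fun h0 => H ⟨_, ?_, hb, by rw [map_mul, map_mul, h0]⟩⟩
      rw [mul_assoc, (hidem e).eq]
  · obtain ⟨b, hb, hψb⟩ := hker
    by_contra! H
    refine hb (eq_zero_of_forall_mul_eq_zero hmax fun d e => ?_)
    by_contra hne
    refine (H e).not_ge (hsmall e ⟨b * d * i e, ?_, hne, ?_⟩)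
    · rw [mul_assoc, (hidem e).eq]
    · rw [map_mul, map_mul, hψb, zero_mul, zero_mul]

end Quotient

theorem K0.card_le_rank_of_surjective {k : Type u} {B : Type v} [Field k] [Ring B] [Algebra k B]
    {ι : Type*} [Fintype ι] {i : ι → B} (hidem : ∀ e, IsIdempotentElem (i e))
    (hmax : ∀ m : Ideal B, m.IsMaximal →
      ∃ e, (∃ b, i e * b ∉ m) ∧ ∀ f, f ≠ e → ∀ b, i f * b ∈ m)
    {A : Type w} [Ring A] [Algebra k A] [Module.Finite k A] {ψ : B →ₐ[k] A}
    (hψ : Function.Surjective ψ) [DecidablePred fun e => ψ (i e) ≠ 0] :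
    ((Finset.univ.filter fun e => ψ (i e) ≠ 0).card : Cardinal) ≤ Module.rank ℤ (K0 A) := by
  have hid : ∀ e, IsIdempotentElem (ψ (i e)) := fun e => by
    rw [IsIdempotentElem, ← map_mul, (hidem e).eq]
  have hm : ∀ e : {e // ψ (i e) ≠ 0}, ∃ m : Ideal A, ψ (i e) ∉ m ∧
      ∀ f, f ≠ e.1 → ∀ a, ψ (i f) * a ∈ m := by
    rintro ⟨e, he⟩
    -- A maximal left ideal containing `1 - ψ (i e)` omits `ψ (i e)`, so its pullback to `B` must be
    -- one attached to the edge `e`.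
    have hne : Ideal.span {1 - ψ (i e)} ≠ ⊤ := by
      intro htop
      rw [Ideal.eq_top_iff_one, Ideal.mem_span_singleton'] at htop
      obtain ⟨a, ha⟩ := htop
      apply he
      rw [← one_mul (ψ (i e)), ← ha, mul_assoc, sub_mul, one_mul, (hid e).eq, sub_self, mul_zero]
    obtain ⟨m, hm, hle⟩ := Ideal.exists_le_maximal _ hne
    have hnot : ψ (i e) ∉ m := fun hmem => hm.ne_top ((Ideal.eq_top_iff_one m).mpr (by
      have := m.add_mem (hle (Ideal.mem_span_singleton_self _)) hmem
      rwa [sub_add_cancel] at this))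
    refine ⟨m, hnot, ?_⟩
    obtain ⟨g, _, hg⟩ := hmax (m.comap ψ) (Ideal.comap_isMaximal_of_surjective ψ hψ)
    have hge : e = g := by
      by_contra hne'
      have := hg e hne' 1
      rw [mul_one] at this
      exact hnot this
    subst hge
    intro f hf a
    obtain ⟨b, rfl⟩ := hψ a
    rw [← map_mul]
    exact hg f hf b
  choose m hnot hmem using hm
  have := K0.card_le_rank (k := k) (j := fun e : {e // ψ (i e) ≠ 0} => ψ (i e)) (fun e => hid e) m
    (fun e f hef => hmem f e fun h => hef (Subtype.ext h)) hnot
  rwa [Fintype.card_subtype] at this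

/-! ### The comparison of ranks -/

theorem mainTheorem7
    {R : Type u} [CommRing R] [IsDomain R] [IsDiscreteValuationRing R]
    [IsAdicComplete (IsLocalRing.maximalIdeal R) R]
    {K : Type v} [Field K] [Algebra R K] [IsFractionRing R K]
    {B : Type w} [Ring B] [Algebra (IsLocalRing.ResidueField R) B]
    {V : Type*} [Finite V] (Γ : BrauerTree V)
    (hstem : Γ.IsStem) (hexc : Γ.NoExceptionalVertex)
    (hB : IsBrauerTreeAlgebra (IsLocalRing.ResidueField R) B Γ)
    {Λ : Type x} [Ring Λ] [Algebra R Λ] (hΛ : IsROrder R K Λ)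
    (I : Ideal B) [I.IsTwoSided] (hI : I ≠ ⊥) (hI' : I ≠ ⊤)
    (φ : (IsLocalRing.ResidueField R ⊗[R] Λ) ≃ₐ[IsLocalRing.ResidueField R] (B ⧸ I)) :
    Cardinal.lift.{w + 1} (Module.rank ℤ (K0 (K ⊗[R] Λ))) ≤
      Cardinal.lift.{(max v x) + 1} (Module.rank ℤ (K0 (B ⧸ I))) := by
  classical
  have := hΛ.finite
  have := hΛ.projective
  have := hΛ.semisimple
  have := hB.finite
  have : Module.Free R Λ := Module.free_of_flat_of_isLocalRing
  have : Fintype Γ.Edge := Fintype.ofFinite _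
  obtain ⟨i, J, hidem, hJ, hmax, hlow, hup, hr⟩ := hB.exists_idempotents hstem hexc
  let q : B →ₐ[IsLocalRing.ResidueField R] B ⧸ I := Ideal.Quotient.mkₐ _ I
  have hq : Function.Surjective q := Ideal.Quotient.mkₐ_surjective _ I
  have hker : ∃ b, b ≠ 0 ∧ (φ.symm.toAlgHom.comp q) b = 0 := by
    obtain ⟨b, hb, hb0⟩ := Submodule.exists_mem_ne_zero_of_ne_bot hI
    refine ⟨b, hb0, ?_⟩
    have hqb : q b = 0 := Ideal.Quotient.eq_zero_iff_mem.mpr hb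
    rw [AlgHom.comp_apply, hqb, map_zero]
  have hbounds := PeirceBounds.of_surjective hB.symmetric hidem hJ
    (fun m hm => (hmax m hm).imp fun e he => he.1) hlow hup hr Γ.reflTransGen_isRotation
    (ψ := φ.symm.toAlgHom.comp q) (φ.symm.surjective.comp hq) hker
  obtain ⟨ε, hε, hε0⟩ := hbounds.exists_lift (K := K)
  have hle : (Finset.univ.filter fun e => ε e ≠ 0).card ≤
      (Finset.univ.filter fun e => q (i e) ≠ 0).card := by
    refine Finset.card_le_card fun e he => ?_
    rw [Finset.mem_filter] at he ⊢
    refine ⟨he.1, fun h0 => he.2 (hε0 e ?_)⟩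
    rw [AlgHom.comp_apply, h0, map_zero]
  have hupper : Cardinal.lift.{w + 1} (Module.rank ℤ (K0 (K ⊗[R] Λ))) ≤
      ((Finset.univ.filter fun e => q (i e) ≠ 0).card : ℕ) := by
    have h1 := Cardinal.lift_le.{w + 1}.mpr hε.rank_K0_le
    rw [Cardinal.lift_natCast] at h1
    exact h1.trans (by exact_mod_cast hle)
  have hfin : Module.Finite (IsLocalRing.ResidueField R) (B ⧸ I) :=
    Module.Finite.of_surjective q.toLinearMap hq
  have hlower := Cardinal.lift_le.{(max v x) + 1}.mpr
    (K0.card_le_rank_of_surjective hidem hmax hq)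
  rw [Cardinal.lift_natCast] at hlower
  exact hupper.trans hlower
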